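/- A \emph{quasigroup} is a nonempty set $Q$ with operations $\cdot,\setminus,/$ satisfying $a(a\setminus b)=b$, $(b/a)a=b$, $a\setminus(ab)=b$, $(ba)/a=b$. It is a \emph{left} (\emph{right}) \emph{loop} if there is $e\in Q$ with $ea=a$ ($ae=a$) for all $a\in Q$, and a \emph{loop} if there is $e\in Q$ with $ea=ae=a$ for all $a\in Q$. An identity $\alpha=\beta$ with $\alpha\neq\beta$ is of \emph{Bol--Moufang type} if $\alpha,\beta$ are terms in $\cdot$ alone, the same three variables appear on both sides in the same order, one of them twice on each side and the other two once on each side. A variety of quasigroups is of \emph{Bol--Moufang type} if it consists of all quasigroups satisfying one identity of Bol--Moufang type. Let $A,B,C,D,E,F$ denote the words $xxyz$, $xyxz$, $xyyz$, $xyzx$, $xyzy$, $xyzz$, and $1,\dots,5$ the bracketings $o(o(oo))$, $o((oo)o)$, $(oo)(oo)$, $(o(oo))o$, $((oo)o)o$. For $i<j$ let $Xij$ be the identity whose left (right) side is the word $X$ bracketed according to $i$ ($j$). \textbf{Theorem.} There are exactly $26$ varieties of quasigroups of Bol--Moufang type. They are the following $26$ pairwise distinct varieties, listed with their defining identity. GR: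 $x(yz)=(xy)z$; RG1: $x((xy)z)=((xx)y)z$; LG1: $x(y(zz))=(x(yz))z$; RG2: $x((xy)z)=(xx)(yz)$; LG2: $(xy)(zz)=(x(yz))z$; RG3: $x((yx)z)=((xy)x)z$; LG3: $x(y(zy))=(x(yz))y$; EQ: $x(y(zx))=((xy)z)x$; MQ: $(xy)(zx)=(x(yz))x$; LBQ: $x(y(xz))=(x(yx))z$; RBQ: $x((yz)y)=((xy)z)y$; CQ: $x(y(yz))=((xy)y)z$; LC1: $(xx)(yz)=(x(xy))z$; LC2: $x(x(yz))=(x(xy))z$; LC3: $x(x(yz))=((xx)y)z$; LC4: $x(y(yz))=(x(yy))z$; RC1: $x((yz)z)=(xy)(zz)$; RC2: $x((yz)z)=((xy)z)z$; RC3: $x(y(zz))=((xy)z)z$; RC4: $x((yy)z)=((xy)y)z$; LAQ: $x(xy)=(xx)y$; RAQ: $x(yy)=(xy)y$; FQ: $x(yx)=(xy)x$; LNQ: $(xx)(yz)=((xx)y)z$; MNQ: $x((yy)z)=(x(yy))z$; RNQ: $x(y(zz))=(xy)(zz)$. \emph{Equivalent identities.} Up to renaming the variables and interchanging the two sides, the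 identities of Bol--Moufang type that define a given one of these varieties are exactly: GR: $A12$, $A24$, $B12$, $B13$, $B24$, $B34$, $B35$, $C13$, $C23$, $C34$, $C35$, $D12$, $D13$, $D35$, $D45$, $E13$, $E23$, $E24$, $E35$, $E45$, $F24$, $F45$; RG1: $A25$, $D25$; LG1: $D14$, $F14$; RG2: $A23$; LG2: $F34$; RG3: $B25$; LG3: $E14$; EQ: $B23$, $D15$, $E34$; MQ: $B15$, $D23$, $D34$, $E15$; LBQ: $B14$; RBQ: $E25$; CQ: $C15$; LC1: $A34$; LC2: $A14$; LC3: $A15$; LC4: $C14$; RC1: $F23$; RC2: $F25$; RC3: $F15$; RC4: $C25$; LAQ: $A13$, $A45$, $C12$; RAQ: $C45$, $F12$, $F35$; FQ: $B45$, $D24$, $E12$; LNQ: $A35$; MNQ: $C24$; RNQ: $F13$. \emph{Inclusions.} For two of these varieties, $\mathcal V\subseteq\mathcal W$ holds if and only if it follows by reflexivity and transitivity from the inclusions: GR in LG1, LG2, EQ, RG2, RG1; LG1 in LG3, LC4, LBQ; RG1 in RG3, RC4, RBQ; EQ in LC1, MQ, CQ, RC1; MQ in LBQ, LAQ, FQ,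 RAQ, RBQ; LC1 in LC4, LC3, LNQ, LAQ, MNQ; RC1 in RC4, RC3, RNQ, RAQ, MNQ; LC4 in LC2; RC4 in RC2. (For every other pair there is a quasigroup in $\mathcal V\setminus\mathcal W$.) \emph{Neutral elements.} Every member of GR, EQ, MQ, LC1, RC1, MNQ is a loop. Each of RG1, RG2, RG3, RBQ, RC4, LC3, LAQ, LNQ consists of left loops and has a member that is not a loop. Each of LG1, LG2, LG3, LBQ, LC4, RC3, RAQ, RNQ consists of right loops and has a member that is not a loop. Each of LC2, RC2, FQ, CQ has a member that is not a left loop and a member that is not a right loop. -/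

import Mathlib

universe u

namespace BolMoufang

/-- Quasigroups as algebras `(Q, ·, \, /)`: `ldiv a b` is `a \ b` and `rdiv b a` is `b / a`. -/
class Quasigroup (Q : Type u) extends Mul Q where
  ldiv : Q → Q → Q
  rdiv : Q → Q → Q
  mul_ldiv : ∀ a b : Q, a * ldiv a b = b
  rdiv_mul : ∀ a b : Q, rdiv b a * a = b
  ldiv_mul : ∀ a b : Q, ldiv a (a * b) = b
  mul_rdiv : ∀ a b : Q, rdiv (b * a) a = b

/-- A (nonempty) quasigroup, bundled with its carrier, so that classes of quasigroups are sets. -/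
structure QuasigroupObj : Type (u + 1) where
  carrier : Type u
  [str : Quasigroup carrier]
  [nonempty : Nonempty carrier]

attribute [instance] QuasigroupObj.str QuasigroupObj.nonempty

/-- `Q` has a left neutral element. -/
def IsLeftLoop (Q : QuasigroupObj.{u}) : Prop :=
  ∃ e : Q.carrier, ∀ a : Q.carrier, e * a = a

/-- `Q` has a right neutral element. -/
def IsRightLoop (Q : QuasigroupObj.{u}) : Prop :=
  ∃ e : Q.carrier, ∀ a : Q.carrier, a * e = a

/-- `Q` has a (two-sided) neutral element. -/
def IsLoop (Q : QuasigroupObj.{u}) : Prop :=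
  ∃ e : Q.carrier, ∀ a : Q.carrier, e * a = a ∧ a * e = a

/-- Terms in the single operation `·` and three variables. -/
abbrev Term := FreeMagma (Fin 3)

/-- The variables of a term, read from left to right. -/
def Term.letters : Term → List (Fin 3)
  | .of v => [v]
  | .mul s t => Term.letters s ++ Term.letters t

/-- A formal identity `lhs = rhs`. -/
structure Identity where
  lhs : Term
  rhs : Term
  deriving DecidableEq

/-- The class of all quasigroups that satisfy `I`, that is, the variety of quasigroups defined by
`I`. -/
def Identity.models (I : Identity) : Set QuasigroupObj.{u} :=
  {Q | ∀ v : Fin 3 → Q.carrier, FreeMagma.lift v I.lhs = FreeMagma.lift v I.rhs}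

/-- The two sides are different terms, the variables appear in the same order on both sides, one of
the three variables appears twice on each side and the other two appear once. -/
def Identity.IsBolMoufang (I : Identity) : Prop :=
  I.lhs ≠ I.rhs ∧ Term.letters I.lhs = Term.letters I.rhs ∧
    ∃ v : Fin 3, (Term.letters I.lhs).count v = 2 ∧
      ∀ w : Fin 3, w ≠ v → (Term.letters I.lhs).count w = 1

/-- `J` arises from `I` by renaming the variables and possibly interchanging the two sides. -/
def Identity.SameUpToRenaming (J I : Identity) : Prop :=
  ∃ σ : Equiv.Perm (Fin 3),
    (J.lhs = FreeMagma.map σ I.lhs ∧ J.rhs = FreeMagma.map σ I.rhs) ∨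
    (J.lhs = FreeMagma.map σ I.rhs ∧ J.rhs = FreeMagma.map σ I.lhs)

/-- The variable `x`. -/
def x : Term := .of 0
/-- The variable `y`. -/
def y : Term := .of 1
/-- The variable `z`. -/
def z : Term := .of 2

/-- The six words `xxyz`, `xyxz`, `xyyz`, `xyzx`, `xyzy`, `xyzz`. -/
inductive Word
  | A | B | C | D | E | F

/-- The five ways of bracketing a word of length four. -/
inductive Bracketing
  | b1 | b2 | b3 | b4 | b5

/-- The product of `a, b, c, d`, in this order, bracketed as prescribed. -/
def Bracketing.apply (i : Bracketing) (a b c d : Term) : Term :=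
  match i with
  | .b1 => a * (b * (c * d))
  | .b2 => a * ((b * c) * d)
  | .b3 => (a * b) * (c * d)
  | .b4 => (a * (b * c)) * d
  | .b5 => ((a * b) * c) * d

/-- The word `X`, bracketed according to `i`. -/
def Word.bracket (X : Word) (i : Bracketing) : Term :=
  match X with
  | .A => i.apply x x y z
  | .B => i.apply x y x z
  | .C => i.apply x y y z
  | .D => i.apply x y z x
  | .E => i.apply x y z y
  | .F => i.apply x y z z

/-- The identity `Xij`: the word `X` bracketed according to `i` equals the word `X` bracketed
according to `j`. -/
def bm (X : Word) (i j : Bracketing) : Identity := ⟨X.bracket i, X.bracket j⟩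

/-- The abbreviated names of the 26 varieties. -/
inductive VarietyName
  | GR | RG1 | LG1 | RG2 | LG2 | RG3 | LG3 | EQ | MQ | LBQ | RBQ | CQ
  | LC1 | LC2 | LC3 | LC4 | RC1 | RC2 | RC3 | RC4
  | LAQ | RAQ | FQ | LNQ | MNQ | RNQ
  deriving DecidableEq

namespace VarietyName

/-- The defining identity of each of the 26 varieties. -/
def definingIdentity : VarietyName → Identity
  | GR => ⟨x * (y * z), (x * y) * z⟩
  | RG1 => ⟨x * ((x * y) * z), ((x * x) * y) * z⟩
  | LG1 => ⟨x * (y * (z * z)), (x * (y * z)) * z⟩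
  | RG2 => ⟨x * ((x * y) * z), (x * x) * (y * z)⟩
  | LG2 => ⟨(x * y) * (z * z), (x * (y * z)) * z⟩
  | RG3 => ⟨x * ((y * x) * z), ((x * y) * x) * z⟩
  | LG3 => ⟨x * (y * (z * y)), (x * (y * z)) * y⟩
  | EQ => ⟨x * (y * (z * x)), ((x * y) * z) * x⟩
  | MQ => ⟨(x * y) * (z * x), (x * (y * z)) * x⟩
  | LBQ => ⟨x * (y * (x * z)), (x * (y * x)) * z⟩
  | RBQ => ⟨x * ((y * z) * y), ((x * y) * z) * y⟩
  | CQ => ⟨x * (y * (y * z)), ((x * y) * y) * z⟩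
  | LC1 => ⟨(x * x) * (y * z), (x * (x * y)) * z⟩
  | LC2 => ⟨x * (x * (y * z)), (x * (x * y)) * z⟩
  | LC3 => ⟨x * (x * (y * z)), ((x * x) * y) * z⟩
  | LC4 => ⟨x * (y * (y * z)), (x * (y * y)) * z⟩
  | RC1 => ⟨x * ((y * z) * z), (x * y) * (z * z)⟩
  | RC2 => ⟨x * ((y * z) * z), ((x * y) * z) * z⟩
  | RC3 => ⟨x * (y * (z * z)), ((x * y) * z) * z⟩
  | RC4 => ⟨x * ((y * y) * z), ((x * y) * y) * z⟩
  | LAQ => ⟨x * (x * y), (x * x) * y⟩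
  | RAQ => ⟨x * (y * y), (x * y) * y⟩
  | FQ => ⟨x * (y * x), (x * y) * x⟩
  | LNQ => ⟨(x * x) * (y * z), ((x * x) * y) * z⟩
  | MNQ => ⟨x * ((y * y) * z), (x * (y * y)) * z⟩
  | RNQ => ⟨x * (y * (z * z)), (x * y) * (z * z)⟩

/-- The variety of quasigroups with the given name. -/
def variety (V : VarietyName) : Set QuasigroupObj.{u} := V.definingIdentity.models

/-- The Bol-Moufang identities `Xij` that define the given variety. -/
def equivalentIdentities : VarietyName → List Identity
  | GR =>
    [bm .A .b1 .b2, bm .A .b2 .b4,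
     bm .B .b1 .b2, bm .B .b1 .b3, bm .B .b2 .b4, bm .B .b3 .b4, bm .B .b3 .b5,
     bm .C .b1 .b3, bm .C .b2 .b3, bm .C .b3 .b4, bm .C .b3 .b5,
     bm .D .b1 .b2, bm .D .b1 .b3, bm .D .b3 .b5, bm .D .b4 .b5,
     bm .E .b1 .b3, bm .E .b2 .b3, bm .E .b2 .b4, bm .E .b3 .b5, bm .E .b4 .b5,
     bm .F .b2 .b4, bm .F .b4 .b5]
  | RG1 => [bm .A .b2 .b5, bm .D .b2 .b5]
  | LG1 => [bm .D .b1 .b4, bm .F .b1 .b4]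
  | RG2 => [bm .A .b2 .b3]
  | LG2 => [bm .F .b3 .b4]
  | RG3 => [bm .B .b2 .b5]
  | LG3 => [bm .E .b1 .b4]
  | EQ => [bm .B .b2 .b3, bm .D .b1 .b5, bm .E .b3 .b4]
  | MQ => [bm .B .b1 .b5, bm .D .b2 .b3, bm .D .b3 .b4, bm .E .b1 .b5]
  | LBQ => [bm .B .b1 .b4]
  | RBQ => [bm .E .b2 .b5]
  | CQ => [bm .C .b1 .b5]
  | LC1 => [bm .A .b3 .b4]
  | LC2 => [bm .A .b1 .b4]
  | LC3 => [bm .A .b1 .b5]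
  | LC4 => [bm .C .b1 .b4]
  | RC1 => [bm .F .b2 .b3]
  | RC2 => [bm .F .b2 .b5]
  | RC3 => [bm .F .b1 .b5]
  | RC4 => [bm .C .b2 .b5]
  | LAQ => [bm .A .b1 .b3, bm .A .b4 .b5, bm .C .b1 .b2]
  | RAQ => [bm .C .b4 .b5, bm .F .b1 .b2, bm .F .b3 .b5]
  | FQ => [bm .B .b4 .b5, bm .D .b2 .b4, bm .E .b1 .b2]
  | LNQ => [bm .A .b3 .b5]
  | MNQ => [bm .C .b2 .b4]
  | RNQ => [bm .F .b1 .b3]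

/-- The edges of the Hasse diagram: the varieties joined to the given one by an edge and larger
than it. -/
def upperCovers : VarietyName → List VarietyName
  | GR => [LG1, LG2, EQ, RG2, RG1]
  | LG1 => [LG3, LC4, LBQ]
  | RG1 => [RG3, RC4, RBQ]
  | EQ => [LC1, MQ, CQ, RC1]
  | MQ => [LBQ, LAQ, FQ, RAQ, RBQ]
  | LC1 => [LC4, LC3, LNQ, LAQ, MNQ]
  | RC1 => [RC4, RC3, RNQ, RAQ, MNQ]
  | LC4 => [LC2]
  | RC4 => [RC2]
  | LG2 | RG2 | LG3 | RG3 | LBQ | RBQ | CQ | LC2 | LC3 | RC2 | RC3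
  | LAQ | RAQ | FQ | LNQ | MNQ | RNQ => []

/-- There is an ascending path (possibly of length zero) from `V` to `W` in the Hasse diagram. -/
def Below (V W : VarietyName) : Prop :=
  Relation.ReflTransGen (fun A B : VarietyName => B ∈ A.upperCovers) V W

end VarietyName

/-- The four possible behaviours of a variety with respect to neutral elements. -/
inductive NeutralType
  | two | left | right | none

/-- The class `𝒱` of quasigroups behaves as the label says. -/
def NeutralType.Describes (τ : NeutralType) (𝒱 : Set QuasigroupObj.{u}) : Prop :=
  match τ with
  | .two => ∀ Q ∈ 𝒱, IsLoop Q
  | .left => (∀ Q ∈ 𝒱, IsLeftLoop Q) ∧ ∃ Q ∈ 𝒱, ¬ IsLoop Q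
  | .right => (∀ Q ∈ 𝒱, IsRightLoop Q) ∧ ∃ Q ∈ 𝒱, ¬ IsLoop Q
  | .none => (∃ Q ∈ 𝒱, ¬ IsLeftLoop Q) ∧ ∃ Q ∈ 𝒱, ¬ IsRightLoop Q

/-- The label of each of the 26 varieties. -/
def VarietyName.neutralType : VarietyName → NeutralType
  | GR | EQ | MQ | LC1 | RC1 | MNQ => .two
  | RG1 | RG2 | RG3 | RBQ | RC4 | LC3 | LAQ | LNQ => .left
  | LG1 | LG2 | LG3 | LBQ | LC4 | RC3 | RAQ | RNQ => .right
  | LC2 | RC2 | FQ | CQ => .none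

end BolMoufang

/-!
Reversing all products turns identities of Bol-Moufang type into identities of the same type, and
models into opposite quasigroups, so that nearly everything has to be proved only up to duality.
Throughout, a lemma called `V_of_Xij` or `Xij_of_V` relates the identity `Xij` to the defining
identity of the variety `V`.

*Classification.* A term is determined by its letters and its bracketing, so up to renaming and
interchanging sides there are 6 · 10 = 60 identities of Bol-Moufang type, and each occurs in one of
the 26 lists (`Identity.IsBolMoufang.exists_variety`). All identities in one list define the same
variety (`VarietyName.models_eq_variety`). For most pairs this is a matter of renaming, cancelling a
factor or substituting a product for a variable, since translations are surjective. The pairs that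
need an argument are `C23` and `B34` for groups (`GR_of_C23`, `GR_of_B34`), `A25` and `D25` for
`RG1`, where the quasigroup turns out to be a group twisted by an involutive automorphism
(`rebracket_of_twisted_assoc`), `B15` for Moufang quasigroups (`MQ_of_B15`, `B15_of_MQ`), and `B23`
for extra quasigroups (`EQ_of_B23`, `B23_of_EQ`). In the last two the decisive step is to find the
neutral element from the identity (`loop_of_B15`, `loop_of_B23`); after that the inverse property
holds, and inversion, being an antiautomorphism, converts one identity into the other.

*Inclusions and neutral elements.* The edges of the Hasse diagram are among the same computations;
the least immediate ones are that extra quasigroups are Moufang (`MQ_of_EQ`) and belong to `LC1`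
(`LC1_of_EQ`), and that passing to the inverses of left translations turns `LC4` into `LC2`
(`LC2_of_LC4`). For neutral elements the recurring argument is that a local neutral element of a
single element is neutral for all elements.

*Non-inclusions.* For every variety other than `GR`, up to duality, a finite quasigroup lies in that
variety and in no variety outside the upper set determined by the Hasse diagram (`IsSeparating`).
For `MQ` and `EQ` these are the Chein doubles of the dihedral groups of order 6 and 8; the others
have order at most 12 and are given by tables. Only for `LC3` two models are used: one that also
lies in `RG2`, and the model of `LC1`, which does not. Since the Hasse diagram has no cycles, the 26
varieties are pairwise distinct (`VarietyName.variety_injective`), and the table models without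
one-sided neutral elements also show that the claims about neutral elements are sharp.
-/

namespace BolMoufang

/-! ### Finite enumerations -/

instance : DecidableEq Word := fun X Y => by
  cases X <;> cases Y <;> first | exact isTrue rfl | exact isFalse nofun

instance : DecidableEq Bracketing := fun i j => by
  cases i <;> cases j <;> first | exact isTrue rfl | exact isFalse nofun

instance : Fintype Word where
  elems := {.A, .B, .C, .D, .E, .F}
  complete X := by cases X <;> simp

instance : Fintype Bracketing where
  elems := {.b1, .b2, .b3, .b4, .b5}
  complete i := by cases i <;> simp

instance : Fintype VarietyName where
  elems := {.GR, .RG1, .LG1, .RG2, .LG2, .RG3, .LG3, .EQ, .MQ, .LBQ, .RBQ, .CQ,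
    .LC1, .LC2, .LC3, .LC4, .RC1, .RC2, .RC3, .RC4, .LAQ, .RAQ, .FQ, .LNQ, .MNQ, .RNQ}
  complete V := by cases V <;> simp

instance (J I : Identity) : Decidable (J.SameUpToRenaming I) :=
  inferInstanceAs (Decidable (∃ _σ : Equiv.Perm (Fin 3), _ ∨ _))

instance (I : Identity) : Decidable I.IsBolMoufang :=
  inferInstanceAs (Decidable (_ ∧ _ ∧ ∃ _v : Fin 3, _))

/-! ### Identities in a single quasigroup, renaming of variables -/

/-- The identity `I` holds in the groupoid `Q`. -/
def Identity.HoldsIn (I : Identity) (Q : Type u) [Mul Q] : Prop :=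
  ∀ a b c : Q, FreeMagma.lift ![a, b, c] I.lhs = FreeMagma.lift ![a, b, c] I.rhs

theorem vec_eta {Q : Type u} (v : Fin 3 → Q) : ![v 0, v 1, v 2] = v := by
  funext i; fin_cases i <;> rfl

theorem Identity.HoldsIn.lift_eq {I : Identity} {Q : Type u} [Mul Q] (h : I.HoldsIn Q)
    (v : Fin 3 → Q) : FreeMagma.lift v I.lhs = FreeMagma.lift v I.rhs := by
  have := h (v 0) (v 1) (v 2)
  rwa [vec_eta] at this

theorem Identity.mem_models {I : Identity} {Q : QuasigroupObj.{u}} :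
    Q ∈ I.models ↔ I.HoldsIn Q.carrier :=
  ⟨fun h a b c => h ![a, b, c], fun h v => h.lift_eq v⟩

theorem lift_map {Q : Type u} [Mul Q] (σ : Fin 3 → Fin 3) (v : Fin 3 → Q) (t : Term) :
    FreeMagma.lift v (FreeMagma.map σ t) = FreeMagma.lift (v ∘ σ) t := by
  induction t using FreeMagma.recOnMul with
  | ih1 i => rfl
  | ih2 s t hs ht => rw [map_mul, map_mul, map_mul, hs, ht]

theorem Identity.SameUpToRenaming.holdsIn_iff {J I : Identity} (h : J.SameUpToRenaming I)
    (Q : Type u) [Mul Q] : J.HoldsIn Q ↔ I.HoldsIn Q := by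
  obtain ⟨σ, h⟩ := h
  have key : (∀ v : Fin 3 → Q, FreeMagma.lift v J.lhs = FreeMagma.lift v J.rhs) ↔
      ∀ v : Fin 3 → Q, FreeMagma.lift v I.lhs = FreeMagma.lift v I.rhs := by
    constructor
    · intro hJ v
      have := hJ (v ∘ σ.symm)
      rcases h with ⟨h₁, h₂⟩ | ⟨h₁, h₂⟩ <;>
        simpa [h₁, h₂, lift_map, Function.comp_assoc, eq_comm] using this
    · intro hI v
      have := hI (v ∘ σ)
      rcases h with ⟨h₁, h₂⟩ | ⟨h₁, h₂⟩ <;>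
        simpa [h₁, h₂, lift_map, eq_comm] using this
  exact ⟨fun h a b c => key.1 h.lift_eq _, fun h a b c => key.2 h.lift_eq _⟩

theorem Identity.SameUpToRenaming.models_eq {J I : Identity} (h : J.SameUpToRenaming I) :
    J.models = (I.models : Set QuasigroupObj.{u}) := by
  ext Q
  rw [mem_models, mem_models, h.holdsIn_iff]

/-! ### Duality -/

open MulOpposite

instance {Q : Type u} [Quasigroup Q] : Quasigroup Qᵐᵒᵖ where
  ldiv a b := op (Quasigroup.rdiv b.unop a.unop)
  rdiv b a := op (Quasigroup.ldiv a.unop b.unop)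
  mul_ldiv a b := congrArg op (Quasigroup.rdiv_mul a.unop b.unop)
  rdiv_mul a b := congrArg op (Quasigroup.mul_ldiv a.unop b.unop)
  ldiv_mul a b := congrArg op (Quasigroup.mul_rdiv a.unop b.unop)
  mul_rdiv a b := congrArg op (Quasigroup.ldiv_mul a.unop b.unop)

/-- The opposite quasigroup. -/
def QuasigroupObj.opposite (Q : QuasigroupObj.{u}) : QuasigroupObj.{u} :=
  haveI : Nonempty Q.carrierᵐᵒᵖ := Q.nonempty.map op
  ⟨Q.carrierᵐᵒᵖ⟩

/-- The mirror image of a term. -/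
def Term.reverse : Term → Term
  | .of v => .of v
  | .mul s t => Term.reverse t * Term.reverse s

/-- The mirror image of an identity. -/
def Identity.dual (I : Identity) : Identity := ⟨I.lhs.reverse, I.rhs.reverse⟩

theorem unop_lift_op {Q : Type u} [Mul Q] (v : Fin 3 → Q) (t : Term) :
    unop (FreeMagma.lift (fun i => op (v i)) t) = FreeMagma.lift v t.reverse := by
  induction t using FreeMagma.recOnMul with
  | ih1 i => rfl
  | ih2 s t hs ht => rw [map_mul, unop_mul, hs, ht, ← map_mul]; rfl

theorem Identity.holdsIn_op {I : Identity} {Q : Type u} [Mul Q] :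
    I.HoldsIn Qᵐᵒᵖ ↔ I.dual.HoldsIn Q := by
  constructor
  · intro h a b c
    have := congrArg unop (h.lift_eq (fun i => op (![a, b, c] i)))
    rwa [unop_lift_op, unop_lift_op] at this
  · intro h a b c
    have := h.lift_eq (fun i => unop (![a, b, c] i))
    erw [← unop_lift_op, ← unop_lift_op] at this
    exact unop_injective this

theorem Identity.opposite_mem_models {I : Identity} {Q : QuasigroupObj.{u}} :
    Q.opposite ∈ I.models ↔ Q ∈ I.dual.models := by
  rw [mem_models, mem_models]
  exact holdsIn_op (Q := Q.carrier)

theorem isRightLoop_opposite {Q : QuasigroupObj.{u}} : IsRightLoop Q.opposite ↔ IsLeftLoop Q :=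
  ⟨fun ⟨e, h⟩ => ⟨unop (α := Q.carrier) e, fun a => congrArg unop (h (op (α := Q.carrier) a))⟩,
    fun ⟨e, h⟩ => ⟨op e, fun a => congrArg op (h (unop (α := Q.carrier) a))⟩⟩

theorem isLeftLoop_opposite {Q : QuasigroupObj.{u}} : IsLeftLoop Q.opposite ↔ IsRightLoop Q :=
  ⟨fun ⟨e, h⟩ => ⟨unop (α := Q.carrier) e, fun a => congrArg unop (h (op (α := Q.carrier) a))⟩,
    fun ⟨e, h⟩ => ⟨op e, fun a => congrArg op (h (unop (α := Q.carrier) a))⟩⟩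

theorem isLoop_opposite {Q : QuasigroupObj.{u}} : IsLoop Q.opposite ↔ IsLoop Q :=
  ⟨fun ⟨e, h⟩ => ⟨unop (α := Q.carrier) e, fun a =>
      ⟨congrArg unop (h (op (α := Q.carrier) a)).2, congrArg unop (h (op (α := Q.carrier) a)).1⟩⟩,
    fun ⟨e, h⟩ => ⟨op e, fun a => ⟨congrArg op (h (unop (α := Q.carrier) a)).2,
      congrArg op (h (unop (α := Q.carrier) a)).1⟩⟩⟩

/-- The name of the variety of opposites of the members of a variety. -/
def VarietyName.dual : VarietyName → VarietyName
  | .GR => .GR | .EQ => .EQ | .MQ => .MQ | .CQ => .CQ | .FQ => .FQ | .MNQ => .MNQ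
  | .RG1 => .LG1 | .LG1 => .RG1 | .RG2 => .LG2 | .LG2 => .RG2 | .RG3 => .LG3 | .LG3 => .RG3
  | .LBQ => .RBQ | .RBQ => .LBQ | .LC1 => .RC1 | .RC1 => .LC1 | .LC2 => .RC2 | .RC2 => .LC2
  | .LC3 => .RC3 | .RC3 => .LC3 | .LC4 => .RC4 | .RC4 => .LC4 | .LAQ => .RAQ | .RAQ => .LAQ
  | .LNQ => .RNQ | .RNQ => .LNQ

theorem VarietyName.dual_dual (V : VarietyName) : V.dual.dual = V := by cases V <;> rfl

/-- Up to renaming, the listed defining identities are closed under mirror images, except for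
that of `MQ`, whose mirror image is a different identity that defines the same variety. -/
theorem VarietyName.definingIdentity_dual : ∀ V : VarietyName, V ≠ .MQ →
    V.dual.definingIdentity.SameUpToRenaming V.definingIdentity.dual := by
  decide +kernel

/-! ### The sixty identities -/

theorem Term.letters_mul (s t : Term) : Term.letters (s * t) = s.letters ++ t.letters := rfl

theorem Term.letters_ne_nil (t : Term) : t.letters ≠ [] := by
  induction t using FreeMagma.recOnMul with
  | ih1 i => simp [Term.letters]
  | ih2 s t hs ht => simp [Term.letters_mul, hs]

theorem Term.eq_of_letters_eq_one {t : Term} {a : Fin 3} (h : t.letters = [a]) : t = .of a := by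
  induction t using FreeMagma.recOnMul with
  | ih1 i => rw [Term.letters, List.singleton_inj] at h; rw [h]
  | ih2 s t hs ht =>
    rw [Term.letters_mul, List.append_eq_singleton_iff] at h
    simp [Term.letters_ne_nil] at h

theorem Term.eq_of_letters_eq_two {t : Term} {a b : Fin 3} (h : t.letters = [a, b]) :
    t = .of a * .of b := by
  induction t using FreeMagma.recOnMul with
  | ih1 i => simp [Term.letters] at h
  | ih2 s t hs ht =>
    rw [Term.letters_mul, List.append_eq_cons_iff] at h
    rcases h with ⟨h, -⟩ | ⟨l, hs', h⟩
    · exact absurd h (Term.letters_ne_nil s)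
    rw [eq_comm, List.append_eq_singleton_iff] at h
    rcases h with ⟨rfl, h⟩ | ⟨-, h⟩
    · rw [eq_of_letters_eq_one hs', eq_of_letters_eq_one h]
    · exact absurd h (Term.letters_ne_nil t)

theorem Term.eq_of_letters_eq_three {t : Term} {a b c : Fin 3} (h : t.letters = [a, b, c]) :
    t = .of a * (.of b * .of c) ∨ t = (.of a * .of b) * .of c := by
  induction t using FreeMagma.recOnMul with
  | ih1 i => simp [Term.letters] at h
  | ih2 s t hs ht =>
    rw [Term.letters_mul, List.append_eq_cons_iff] at h
    rcases h with ⟨h, -⟩ | ⟨l, hs', h⟩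
    · exact absurd h (Term.letters_ne_nil s)
    rw [eq_comm, List.append_eq_cons_iff] at h
    rcases h with ⟨rfl, h⟩ | ⟨l, rfl, h⟩
    · exact .inl (by rw [eq_of_letters_eq_one hs', eq_of_letters_eq_two h])
    rw [eq_comm, List.append_eq_singleton_iff] at h
    rcases h with ⟨rfl, h⟩ | ⟨-, h⟩
    · exact .inr (by rw [eq_of_letters_eq_two hs', eq_of_letters_eq_one h])
    · exact absurd h (Term.letters_ne_nil t)

/-- There are just five ways of bracketing a word of length four. -/
theorem Term.eq_of_letters_eq_four {t : Term} {a b c d : Fin 3} (h : t.letters = [a, b, c, d]) :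
    ∃ i : Bracketing, t = i.apply (.of a) (.of b) (.of c) (.of d) := by
  induction t using FreeMagma.recOnMul with
  | ih1 i => simp [Term.letters] at h
  | ih2 s t hs ht =>
    rw [Term.letters_mul, List.append_eq_cons_iff] at h
    rcases h with ⟨h, -⟩ | ⟨l, hs', h⟩
    · exact absurd h (Term.letters_ne_nil s)
    rw [eq_comm, List.append_eq_cons_iff] at h
    rcases h with ⟨rfl, h⟩ | ⟨l, rfl, h⟩
    · rw [eq_of_letters_eq_one hs']
      rcases eq_of_letters_eq_three h with rfl | rfl
      exacts [⟨.b1, rfl⟩, ⟨.b2, rfl⟩]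
    rw [eq_comm, List.append_eq_cons_iff] at h
    rcases h with ⟨rfl, h⟩ | ⟨l, rfl, h⟩
    · rw [eq_of_letters_eq_two hs', eq_of_letters_eq_two h]
      exact ⟨.b3, rfl⟩
    rw [eq_comm, List.append_eq_singleton_iff] at h
    rcases h with ⟨rfl, h⟩ | ⟨-, h⟩
    · rw [eq_of_letters_eq_one h]
      rcases eq_of_letters_eq_three hs' with rfl | rfl
      exacts [⟨.b4, rfl⟩, ⟨.b5, rfl⟩]
    · exact absurd h (Term.letters_ne_nil t)

/-- Up to renaming, there are only the six words `A`, ..., `F`. -/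
theorem exists_word : ∀ a b c d : Fin 3,
    (∃ v : Fin 3, [a, b, c, d].count v = 2 ∧ ∀ w : Fin 3, w ≠ v → [a, b, c, d].count w = 1) →
    ∃ (X : Word) (σ : Equiv.Perm (Fin 3)), ∀ i : Bracketing,
      i.apply (.of a) (.of b) (.of c) (.of d) = FreeMagma.map σ (X.bracket i) := by
  decide +kernel

theorem length_eq_sum_count (l : List (Fin 3)) : l.length = l.count 0 + l.count 1 + l.count 2 := by
  induction l with
  | nil => rfl
  | cons a l ih => fin_cases a <;> simp [ih] <;> omega

theorem Identity.IsBolMoufang.exists_sameUpToRenaming_bm {J : Identity} (h : J.IsBolMoufang) :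
    ∃ (X : Word) (i j : Bracketing), i ≠ j ∧ J.SameUpToRenaming (bm X i j) := by
  obtain ⟨hne, hl, v, hv, hw⟩ := h
  have hlen : (Term.letters J.lhs).length = 4 := by
    have := length_eq_sum_count (Term.letters J.lhs)
    have h0 := hw 0
    have h1 := hw 1
    have h2 := hw 2
    fin_cases v <;> simp_all
  obtain ⟨a, b, c, d, habcd⟩ := List.length_eq_four.1 hlen
  obtain ⟨i, hi⟩ := Term.eq_of_letters_eq_four habcd
  obtain ⟨j, hj⟩ := Term.eq_of_letters_eq_four (hl ▸ habcd)
  obtain ⟨X, σ, hσ⟩ := exists_word a b c d ⟨v, habcd ▸ hv, habcd ▸ hw⟩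
  refine ⟨X, i, j, ?_, σ, .inl ⟨hi.trans (hσ i), hj.trans (hσ j)⟩⟩
  rintro rfl
  exact hne (hi.trans hj.symm)

theorem Identity.SameUpToRenaming.swap {J : Identity} {s t : Term}
    (h : J.SameUpToRenaming ⟨s, t⟩) : J.SameUpToRenaming ⟨t, s⟩ := by
  obtain ⟨σ, h⟩ := h
  exact ⟨σ, h.symm⟩

theorem exists_mem_equivalentIdentities : ∀ (X : Word) (i j : Bracketing), i ≠ j →
    ∃ V : VarietyName, bm X i j ∈ V.equivalentIdentities ∨ bm X j i ∈ V.equivalentIdentities := by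
  decide +kernel

/-- Every identity of Bol-Moufang type occurs in one of the 26 lists of equivalent identities. -/
theorem Identity.IsBolMoufang.exists_variety {J : Identity} (h : J.IsBolMoufang) :
    ∃ V : VarietyName, ∃ I ∈ V.equivalentIdentities, J.SameUpToRenaming I := by
  obtain ⟨X, i, j, hij, hJ⟩ := h.exists_sameUpToRenaming_bm
  obtain ⟨V, hV | hV⟩ := exists_mem_equivalentIdentities X i j hij
  exacts [⟨V, _, hV, hJ⟩, ⟨V, _, hV, hJ.swap⟩]

theorem VarietyName.exists_isBolMoufang :
    ∀ V : VarietyName, ∃ I ∈ V.equivalentIdentities, I.IsBolMoufang := by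
  decide +kernel

/-! ### Quasigroups: cancellation and solvability -/

section Algebra

variable {Q : Type u} [Quasigroup Q]

open Quasigroup

instance : IsLeftCancelMul Q :=
  ⟨fun a b c h => by rw [← ldiv_mul a b, ← ldiv_mul a c]; exact congrArg _ h⟩

instance : IsRightCancelMul Q :=
  ⟨fun a b c h => by rw [← mul_rdiv a b, ← mul_rdiv a c]; exact congrArg (rdiv · a) h⟩

theorem exists_mul_eq (a b : Q) : ∃ c, a * c = b := ⟨ldiv a b, mul_ldiv a b⟩

theorem exists_mul_eq' (a b : Q) : ∃ c, c * a = b := ⟨rdiv b a, rdiv_mul a b⟩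

/-! ### Identities that force a neutral element -/

theorem leftLoop_of_RG2 [Nonempty Q] (h : ∀ x y z : Q, x * ((x * y) * z) = (x * x) * (y * z)) :
    ∃ e : Q, ∀ a, e * a = a := by
  obtain ⟨x⟩ := ‹Nonempty Q›
  obtain ⟨f, hf⟩ := exists_mul_eq' x x
  refine ⟨f, fun a => ?_⟩
  have hff : f * f = f := by
    have := h f x x
    rw [hf] at this
    exact (mul_right_cancel this).symm
  obtain ⟨z, hz⟩ := exists_mul_eq x a
  have := h f a x
  rw [hff] at this
  exact mul_right_cancel (mul_left_cancel this)

theorem leftLoop_of_RG3 [Nonempty Q] (h : ∀ x y z : Q, x * ((y * x) * z) = ((x * y) * x) * z) :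
    ∃ e : Q, ∀ a, e * a = a := by
  obtain ⟨x⟩ := ‹Nonempty Q›
  obtain ⟨f, hf⟩ := exists_mul_eq' x x
  obtain ⟨y, hy⟩ := exists_mul_eq x f
  refine ⟨y * x, fun a => ?_⟩
  have := h x y a
  rw [hy, hf] at this
  exact mul_left_cancel this

theorem leftLoop_of_RBQ [Nonempty Q] (h : ∀ x y z : Q, x * ((y * z) * y) = ((x * y) * z) * y) :
    ∃ e : Q, ∀ a, e * a = a := by
  obtain ⟨y⟩ := ‹Nonempty Q›
  obtain ⟨f, hf⟩ := exists_mul_eq' y y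
  refine ⟨f, fun a => ?_⟩
  obtain ⟨u, rfl⟩ := exists_mul_eq' y a
  obtain ⟨z, rfl⟩ := exists_mul_eq y u
  rw [h, hf]

theorem leftLoop_of_RC4 [Nonempty Q] (h : ∀ x y z : Q, x * ((y * y) * z) = ((x * y) * y) * z) :
    ∃ e : Q, ∀ a, e * a = a := by
  obtain ⟨y⟩ := ‹Nonempty Q›
  obtain ⟨f, hf⟩ := exists_mul_eq' y y
  refine ⟨f, fun a => ?_⟩
  obtain ⟨z, rfl⟩ := exists_mul_eq (y * y) a
  rw [h, hf]

theorem leftLoop_of_LC3 [Nonempty Q] (h : ∀ x y z : Q, x * (x * (y * z)) = ((x * x) * y) * z) :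
    ∃ e : Q, ∀ a, e * a = a := by
  obtain ⟨x⟩ := ‹Nonempty Q›
  obtain ⟨f, hf⟩ := exists_mul_eq' x x
  have h₁ : (f * f) * f = f := by
    have := h f f x
    rw [hf, hf, hf] at this
    exact mul_right_cancel (this.symm.trans hf.symm)
  have h₂ : ∀ z, f * (f * z) = z := fun z => by
    have := h f f z
    rw [h₁] at this
    exact mul_left_cancel this
  refine ⟨f * f, fun a => ?_⟩
  have := h f a a
  rw [h₂] at this
  exact (mul_right_cancel this).symm

theorem leftLoop_of_LAQ [Nonempty Q] (h : ∀ x y : Q, x * (x * y) = (x * x) * y) :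
    ∃ e : Q, ∀ a, e * a = a := by
  obtain ⟨x⟩ := ‹Nonempty Q›
  obtain ⟨f, hf⟩ := exists_mul_eq' x x
  have hff : f * f = f := by
    have := h f x
    rw [hf, hf] at this
    exact mul_right_cancel (this.symm.trans hf.symm)
  refine ⟨f, fun a => ?_⟩
  have := h f a
  rw [hff] at this
  exact mul_left_cancel this

theorem leftLoop_of_LNQ [Nonempty Q] (h : ∀ x y z : Q, (x * x) * (y * z) = ((x * x) * y) * z) :
    ∃ e : Q, ∀ a, e * a = a := by
  obtain ⟨x⟩ := ‹Nonempty Q›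
  obtain ⟨e, he⟩ := exists_mul_eq (x * x) (x * x)
  refine ⟨e, fun a => ?_⟩
  have := h x e a
  rw [he] at this
  exact mul_left_cancel this

theorem loop_of_MNQ [Nonempty Q] (h : ∀ x y z : Q, x * ((y * y) * z) = (x * (y * y)) * z) :
    ∃ e : Q, ∀ a, e * a = a ∧ a * e = a := by
  obtain ⟨y⟩ := ‹Nonempty Q›
  obtain ⟨e, he⟩ := exists_mul_eq (y * y) (y * y)
  have hr : ∀ a, a * e = a := fun a => by
    obtain ⟨x, rfl⟩ := exists_mul_eq' (y * y) a
    rw [← h, he]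
  obtain ⟨f, hf⟩ := exists_mul_eq' (y * y) (y * y)
  have hl : ∀ a, f * a = a := fun a => by
    obtain ⟨z, rfl⟩ := exists_mul_eq (y * y) a
    rw [h, hf]
  have hfe : f = e := (hr f).symm.trans (hl e)
  exact ⟨e, fun a => ⟨hfe ▸ hl a, hr a⟩⟩

theorem loop_of_LC1 [Nonempty Q] (h : ∀ x y z : Q, (x * x) * (y * z) = (x * (x * y)) * z) :
    ∃ e : Q, ∀ a, e * a = a ∧ a * e = a := by
  have key : ∀ x e : Q, x * e = x → ∀ a, e * a = a := fun x e he a => by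
    have := h x e a
    rw [he] at this
    exact mul_left_cancel this
  obtain ⟨x⟩ := ‹Nonempty Q›
  obtain ⟨e, he⟩ := exists_mul_eq x x
  refine ⟨e, fun a => ⟨key x e he a, ?_⟩⟩
  obtain ⟨e', he'⟩ := exists_mul_eq a a
  have : e' * e = e * e := (key a e' he' e).trans (key x e he e).symm
  rw [← mul_right_cancel this, he']

theorem loop_of_MQ [Nonempty Q] (h : ∀ x y z : Q, (x * y) * (z * x) = (x * (y * z)) * x) :
    ∃ e : Q, ∀ a, e * a = a ∧ a * e = a := by
  obtain ⟨x⟩ := ‹Nonempty Q›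
  obtain ⟨f, hf⟩ := exists_mul_eq' x x
  have hr : ∀ a, a * f = a := fun a => by
    have := h x a f
    rw [hf] at this
    exact (mul_left_cancel (mul_right_cancel this)).symm
  refine ⟨f, fun a => ⟨?_, hr a⟩⟩
  have := h f f a
  rw [hr, hr, hr] at this
  exact (mul_left_cancel this).symm

/-! ### Groups -/

theorem GR_of_C23 (h : ∀ x y z : Q, x * ((y * y) * z) = (x * y) * (y * z)) (x y z : Q) :
    x * (y * z) = (x * y) * z := by
  obtain ⟨e, he⟩ := exists_mul_eq x x
  have hee : e * e = e := by
    have := h x e x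
    rw [he] at this
    exact mul_right_cancel (mul_left_cancel this)
  have hr : ∀ a, a * e = a := fun a => by
    have := h a e e
    rw [hee, hee] at this
    exact (mul_right_cancel this).symm
  -- `y'` is the right inverse of `y`; the translations by `y` and `y'` turn out to be inverse
  have h₂ : ∀ y y' : Q, y * y' = e → (y * y) * y' = y := fun y y' hy => by
    have := h x y y'
    rw [hy, hr] at this
    exact mul_left_cancel this
  have h₃ : ∀ a y y' : Q, y * y' = e → (a * y') * y = a := fun a y y' hy => by
    obtain ⟨v, hv⟩ := exists_mul_eq y' y
    have e₁ := h (y * y) y' v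
    rw [hv, h₂ y y' hy] at e₁
    have e₂ : (y' * y') * v = e := mul_left_cancel (e₁.trans (hr (y * y)).symm)
    rw [← hv, ← h, e₂, hr]
  have hl : ∀ a, e * a = a := fun a => by
    obtain ⟨a', ha⟩ := exists_mul_eq a e
    rw [← ha]
    exact h₃ a a a' ha
  obtain ⟨v, rfl⟩ := exists_mul_eq y z
  have := h e y v
  rw [hl, hl] at this
  rw [← this, h]

/-- After the neutral element is found, replacing the last factor in `B34` by it gives the flexible
law, with which `B34` becomes associativity. -/
theorem GR_of_B34 (h : ∀ x y z : Q, (x * y) * (x * z) = (x * (y * x)) * z) (x y z : Q) :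
    x * (y * z) = (x * y) * z := by
  obtain ⟨e', he'⟩ := exists_mul_eq x x
  obtain ⟨w, hw⟩ := exists_mul_eq' x e'
  have hl : ∀ a, (x * w) * a = a := fun a => by
    obtain ⟨b, rfl⟩ := exists_mul_eq x a
    rw [h, hw, he']
  generalize x * w = e at hl
  have hr : ∀ a, a * e = a := fun a => by
    have := h e a a
    rw [hl, hl] at this
    exact (mul_right_cancel this).symm
  obtain ⟨v, rfl⟩ := exists_mul_eq y x
  have h₁ := h y v e
  rw [hr, hr] at h₁
  rw [h, ← h₁]

/-! ### The variety `RG1`: groups twisted by an involutive automorphism -/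

theorem leftLoop_of_A25 [Nonempty Q] (h : ∀ x y z : Q, x * ((x * y) * z) = ((x * x) * y) * z) :
    ∃ e : Q, ∀ a, e * a = a := by
  obtain ⟨x⟩ := ‹Nonempty Q›
  obtain ⟨f, hf⟩ := exists_mul_eq' x x
  have hff : f * f = f := by
    obtain ⟨z, hz⟩ := exists_mul_eq x x
    have := h f x z
    rw [hf, hz, hf] at this
    have h₁ : (f * f) * x = x := mul_right_cancel (this.symm.trans hz.symm)
    exact mul_right_cancel (h₁.trans hf.symm)
  refine ⟨f, fun a => ?_⟩
  have := h f f a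
  rw [hff, hff] at this
  exact mul_left_cancel this

theorem leftLoop_of_D25 [Nonempty Q] (h : ∀ x y z : Q, x * ((y * z) * x) = ((x * y) * z) * x) :
    ∃ e : Q, ∀ a, e * a = a := by
  -- if `f` is the local left neutral element of `y`, then `(yx)w = y` if and only if `xw = f`
  have key : ∀ x y w f : Q, f * y = y → (y * x) * w = y → x * w = f := fun x y w f hf hw => by
    have := h y x w
    rw [hw] at this
    exact mul_right_cancel ((mul_left_cancel this).trans hf.symm)
  have key' : ∀ x y w f : Q, f * y = y → x * w = f → (y * x) * w = y := fun x y w f hf hw => by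
    obtain ⟨w', hw'⟩ := exists_mul_eq (y * x) y
    rw [mul_left_cancel (hw.trans (key x y w' f hf hw').symm), hw']
  obtain ⟨x⟩ := ‹Nonempty Q›
  obtain ⟨f, hf⟩ := exists_mul_eq' x x
  obtain ⟨w, hw⟩ := exists_mul_eq x f
  have hwx : w * x = f := key w x x f hf (by rw [hw, hf])
  have hfx : f * (x * x) = x * x := by
    have := h (x * x) w x
    rw [key' x x w f hf hw, hwx] at this
    exact mul_left_cancel this
  have hff : f * f = f := by
    obtain ⟨g, hg⟩ := exists_mul_eq' f f
    obtain ⟨w', hw'⟩ := exists_mul_eq (x * x) f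
    have := key (x * x) f w' g hg (by rw [hfx, hw'])
    have hgf : g = f := this.symm.trans hw'
    rwa [hgf] at hg
  refine ⟨f, fun a => ?_⟩
  obtain ⟨w', hw'⟩ := exists_mul_eq a f
  exact mul_right_cancel ((key' a f w' f hff hw').trans hw'.symm)

/-- A quasigroup as in the hypotheses is a group, with an involutive automorphism `a ↦ ae`, under
the operation `(a, b) ↦ (ae)b`. In such a quasigroup a product of four factors may be rebracketed
as in `RG1`, whatever the factors are. -/
theorem rebracket_of_twisted_assoc {e : Q} (inv : ∀ a : Q, (a * e) * e = a)
    (assoc : ∀ a b c : Q, (a * b) * c = (a * e) * (b * c)) (x y z w : Q) :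
    x * ((y * z) * w) = ((x * y) * z) * w := by
  rw [assoc x y z, assoc (x * e), inv]

theorem rebracket_of_A25 [Nonempty Q] (h : ∀ x y z : Q, x * ((x * y) * z) = ((x * x) * y) * z)
    (x y z w : Q) : x * ((y * z) * w) = ((x * y) * z) * w := by
  obtain ⟨e, he⟩ := leftLoop_of_A25 h
  -- a composition of two left translations is a left translation
  have trans : ∀ a b t : Q, t * e = a * (b * e) → ∀ c, a * (b * c) = t * c := fun a b t ht c => by
    obtain ⟨d, rfl⟩ := exists_mul_eq a b
    rw [h] at ht
    rw [h, mul_right_cancel ht]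
  have key : ∀ a y : Q, (a * a) * y = rdiv a e * (a * y) := fun a y => by
    obtain ⟨b, hb⟩ := exists_mul_eq a e
    have hab : (a * a) * b = a := by
      have := h a b e
      rw [hb, he] at this
      exact (mul_right_cancel this).symm
    have h₁ := trans a (rdiv b e) e (by rw [rdiv_mul, hb, he]) (a * y)
    rw [he] at h₁
    have h₂ := trans (a * a) (rdiv b e) (rdiv a e) (by rw [rdiv_mul, rdiv_mul, hab]) (a * y)
    rwa [mul_left_cancel h₁] at h₂
  have assoc : ∀ a b c : Q, (a * b) * c = (a * e) * (b * c) := fun a b c => by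
    obtain ⟨d, rfl⟩ := exists_mul_eq (a * e) b
    rw [h (a * e) d c, key (a * e) d, mul_rdiv]
  refine rebracket_of_twisted_assoc (fun a => ?_) assoc x y z w
  have h₁ := key a e
  rw [assoc a a e] at h₁
  rw [mul_right_cancel h₁, rdiv_mul]

theorem rebracket_of_D25 [Nonempty Q] (h : ∀ x y z : Q, x * ((y * z) * x) = ((x * y) * z) * x)
    (x y z w : Q) : x * ((y * z) * w) = ((x * y) * z) * w := by
  obtain ⟨e, he⟩ := leftLoop_of_D25 h
  have inv : ∀ a : Q, (a * e) * e = a := fun a => by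
    have := h a e e
    rw [he, he] at this
    exact (mul_right_cancel this).symm
  -- `(ab)c` depends only on `a` and `bc`
  have key : ∀ a b c : Q, (a * b) * c = (a * ((b * c) * e)) * e := fun a b c => by
    have := h a ((b * c) * e) e
    rw [inv, h] at this
    exact mul_right_cancel this
  refine rebracket_of_twisted_assoc inv (fun a b c => ?_) x y z w
  rw [key, key a e, he]

/-! ### Left C-quasigroups -/

/-- By `LC4`, the composition of the left translations by `y`, `y` and `x` is a left translation. As
the inverses of left translations are left translations, the same holds for the composition by `y`,
`x` and `x`, and evaluating it at the right neutral element gives `LC2`. -/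
theorem LC2_of_LC4 [Nonempty Q] (h : ∀ x y z : Q, x * (y * (y * z)) = (x * (y * y)) * z)
    (x y z : Q) : x * (x * (y * z)) = (x * (x * y)) * z := by
  obtain ⟨e, he⟩ : ∃ e : Q, ∀ a, a * e = a := by
    obtain ⟨e, he⟩ := exists_mul_eq x x
    refine ⟨e, fun a => ?_⟩
    obtain ⟨b, rfl⟩ := exists_mul_eq' (x * x) a
    rw [← h, he]
  have inv : ∀ a : Q, ∃ a', (∀ w, a' * (a * w) = w) ∧ ∀ w, a * (a' * w) = w := fun a => by
    obtain ⟨a', ha⟩ := exists_mul_eq' (a * a) a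
    have h₁ : ∀ w, a' * (a * w) = w := fun w => by
      obtain ⟨v, rfl⟩ := exists_mul_eq a w
      rw [h, ha]
    exact ⟨a', h₁, fun w => mul_left_cancel (h₁ (a' * w))⟩
  obtain ⟨x', hx, hx'⟩ := inv x
  obtain ⟨y', hy, hy'⟩ := inv y
  obtain ⟨p, hp, -⟩ := inv (y' * (x' * x'))
  have key : ∀ w, p * w = x * (x * (y * w)) := fun w => by
    conv_lhs => rw [← hy w, ← hx (y * w), ← hx (x * (y * w)), h, hp]
  have hpe : p = x * (x * y) := by rw [← he p, key, he]
  rw [← key, hpe]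

theorem LAQ_of_LC1 [Nonempty Q] (h : ∀ x y z : Q, (x * x) * (y * z) = (x * (x * y)) * z)
    (x y : Q) : x * (x * y) = (x * x) * y := by
  obtain ⟨e, he⟩ := loop_of_LC1 h
  have := h x y e
  rwa [(he _).2, (he _).2, eq_comm] at this

theorem LNQ_of_LC1 [Nonempty Q] (h : ∀ x y z : Q, (x * x) * (y * z) = (x * (x * y)) * z)
    (x y z : Q) : (x * x) * (y * z) = ((x * x) * y) * z := by
  rw [h, LAQ_of_LC1 h]

theorem LC3_of_LC1 [Nonempty Q] (h : ∀ x y z : Q, (x * x) * (y * z) = (x * (x * y)) * z)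
    (x y z : Q) : x * (x * (y * z)) = ((x * x) * y) * z := by
  rw [LAQ_of_LC1 h, h, LAQ_of_LC1 h]

/-- The identity `LC2`, which is immediate from `LC1`, turns into `LC4` by passing to the inverses
of left translations, as in `LC2_of_LC4`. -/
theorem LC4_of_LC1 [Nonempty Q] (h : ∀ x y z : Q, (x * x) * (y * z) = (x * (x * y)) * z)
    (x y z : Q) : x * (y * (y * z)) = (x * (y * y)) * z := by
  obtain ⟨e, he⟩ := loop_of_LC1 h
  have h₂ : ∀ x y z : Q, x * (x * (y * z)) = (x * (x * y)) * z := fun x y z => by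
    rw [LAQ_of_LC1 h, h]
  have inv : ∀ a : Q, ∃ a', (∀ w, a' * (a * w) = w) ∧ ∀ w, a * (a' * w) = w := fun a => by
    obtain ⟨a', ha⟩ := exists_mul_eq a e
    have h₁ : ∀ w, a * (a' * w) = w := fun w => by
      have := h₂ a a' w
      rw [ha, (he _).2] at this
      exact mul_left_cancel this
    exact ⟨a', fun w => mul_left_cancel (h₁ (a * w)), h₁⟩
  obtain ⟨x', hx, hx'⟩ := inv x
  obtain ⟨y', hy, hy'⟩ := inv y
  obtain ⟨p, hp, -⟩ := inv (y' * (y' * x'))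
  have key : ∀ w, p * w = x * (y * (y * w)) := fun w => by
    conv_lhs => rw [← hy w, ← hy (y * w), ← hx (y * (y * w)), h₂, hp]
  have hpe : p = x * (y * y) := by rw [← (he p).2, key, (he y).2]
  rw [← key, hpe]

theorem MNQ_of_LC1 [Nonempty Q] (h : ∀ x y z : Q, (x * x) * (y * z) = (x * (x * y)) * z)
    (x y z : Q) : x * ((y * y) * z) = (x * (y * y)) * z := by
  rw [← LAQ_of_LC1 h, LC4_of_LC1 h]

/-! ### The inverse property -/

/-- `e` is the neutral element and `inv` is the inversion of a loop with the inverse property. -/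
structure InverseProperty (e : Q) (inv : Q → Q) : Prop where
  one_mul : ∀ a, e * a = a
  mul_one : ∀ a, a * e = a
  inv_mul_cancel_left : ∀ a b, inv a * (a * b) = b
  mul_inv_cancel_left : ∀ a b, a * (inv a * b) = b
  mul_inv_cancel_right : ∀ a b, (b * a) * inv a = b
  inv_mul_cancel_right : ∀ a b, (b * inv a) * a = b

namespace InverseProperty

variable {e : Q} {inv : Q → Q}

theorem of_left_right (he : ∀ a : Q, e * a = a ∧ a * e = a)
    (hl : ∀ a b : Q, a * (inv a * b) = b) (hr : ∀ a b : Q, (b * inv a) * a = b) :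
    InverseProperty e inv where
  one_mul a := (he a).1
  mul_one a := (he a).2
  inv_mul_cancel_left a b := mul_left_cancel (hl a (a * b))
  mul_inv_cancel_left := hl
  mul_inv_cancel_right a b := mul_right_cancel (hr a (b * a))
  inv_mul_cancel_right := hr

/-- Inversion is an antiautomorphism. -/
theorem inv_mul (hi : InverseProperty e inv) (a b : Q) : inv (a * b) = inv b * inv a := by
  have h : inv (a * b) * a = inv b := by
    have := hi.inv_mul_cancel_left (a * b) (inv b)
    rwa [hi.mul_inv_cancel_right] at this
  rw [← h, hi.mul_inv_cancel_right]

end InverseProperty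

/-! ### Moufang quasigroups -/

theorem loop_of_B15 [Nonempty Q] (h : ∀ x y z : Q, x * (y * (x * z)) = ((x * y) * x) * z) :
    ∃ e : Q, ∀ a, e * a = a ∧ a * e = a := by
  -- the local right neutral element of `x` is an idempotent that is also left neutral for `x`,
  -- and left multiplication by it is an involution
  have key : ∀ x e : Q, x * e = x → e * x = x ∧ e * e = e ∧ ∀ z, e * (e * z) = z := by
    intro x e he
    obtain ⟨f, hf⟩ := exists_mul_eq' x x
    obtain ⟨y, hy⟩ := exists_mul_eq x f
    have h₁ : ∀ w, y * (x * w) = w := fun w => by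
      have := h x y w
      rw [hy, hf] at this
      exact mul_left_cancel this
    have h₂ : ∀ w, x * (y * w) = w := fun w => mul_left_cancel (h₁ (y * w))
    have hyx : y * x = e := mul_left_cancel ((h₂ x).trans he.symm)
    have hxy : x * y = e := by
      have h₃ := h x e (y * e)
      have h₄ := h y (x * x) e
      rw [he] at h₃
      rw [h₁, ← h₃, h₂, h₁] at h₄
      exact (mul_right_cancel h₄).symm
    have hex : e * x = x := by rw [← hxy, hy, hf]
    have hey : e * y = y := by
      have := h y x x
      rw [h₁] at this
      rw [← hyx]
      exact (mul_right_cancel this).symm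
    have hee : e * e = e := by
      have := h e x y
      rwa [hex, he, hey, hxy] at this
    refine ⟨hex, hee, fun z => ?_⟩
    have := h e e z
    rw [hee, hee] at this
    exact mul_left_cancel this
  obtain ⟨x⟩ := ‹Nonempty Q›
  obtain ⟨e, he⟩ := exists_mul_eq x x
  obtain ⟨-, hee, he₂⟩ := key x e he
  have huniq : ∀ a g : Q, a * g = a → g = e := fun a g hg => by
    obtain ⟨-, hgg, -⟩ := key a g hg
    have h₁ := h (e * g) e e
    have h₂ := h e g (e * g)
    rw [he₂, hgg] at h₂
    rw [← h₂] at h₁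
    have h₃ : (e * g) * e = e := mul_left_cancel ((mul_left_cancel h₁).trans hee.symm)
    have h₄ : e * g = e := mul_right_cancel (h₃.trans hee.symm)
    exact mul_left_cancel (h₄.trans hee.symm)
  have hr : ∀ a, a * e = a := fun a => by
    obtain ⟨g, hg⟩ := exists_mul_eq a a
    rwa [huniq a g hg] at hg
  refine ⟨e, fun a => ⟨(key a e (hr a)).1, hr a⟩⟩

/-- Given the left inverse property, `h₁` and `h₂` describe the inverses of two kinds of products;
together they yield the right inverse property, and the claim follows by replacing `z` in `B15`
by an element whose product with `x` is the inverse of `z`. -/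
theorem MQ_of_B15 [Nonempty Q] (h : ∀ x y z : Q, x * (y * (x * z)) = ((x * y) * x) * z)
    (x y z : Q) : (x * y) * (z * x) = (x * (y * z)) * x := by
  obtain ⟨e, he⟩ := loop_of_B15 h
  obtain ⟨i, hi⟩ : ∃ i : Q → Q, ∀ a, a * i a = e := ⟨fun a => ldiv a e, fun a => mul_ldiv a e⟩
  have hl : ∀ a b : Q, i a * (a * b) = b := fun a b => by
    have := h a (i a) b
    rw [hi, (he _).1] at this
    exact mul_left_cancel this
  have hl' : ∀ a b : Q, a * (i a * b) = b := fun a b => mul_left_cancel (hl a (i a * b))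
  have hii : ∀ a, i (i a) = a := fun a => mul_left_cancel <| (hi (i a)).trans <| by
    simpa [he] using (hl a e).symm
  have h₁ : ∀ a b : Q, i ((a * b) * a) = (i a * i b) * i a := fun a b => by
    refine mul_right_cancel (b := a * (b * (a * e))) ?_
    rw [← h (i a), hl, hl, hl, h, hl]
  have h₂ : ∀ a b : Q, i (b * a) * a = i a * i (i a * b) := fun a b => by
    have := h a (i a * b) (i a * i (i a * b))
    rw [hl', hl', hi, (he _).2] at this
    rw [← hl (b * a) (i a * i (i a * b)), ← this]
  have ip : InverseProperty e i := .of_left_right he hl' fun a b => by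
    have := h₂ a (a * i (a * b))
    rw [h₁, hl, hii, hl] at this
    exact this
  have := h x (y * z) (i x * i z)
  rw [hl', ip.mul_inv_cancel_right, ← ip.inv_mul] at this
  rw [this, ip.inv_mul_cancel_right]

/-- The mirror image of the identity that defines `MQ` holds in `MQ` as well. -/
theorem D23_of_MQ [Nonempty Q] (h : ∀ x y z : Q, (x * y) * (z * x) = (x * (y * z)) * x)
    (x y z : Q) : x * ((y * z) * x) = (x * y) * (z * x) := by
  obtain ⟨e, he⟩ := loop_of_MQ h
  have flex : ∀ a b : Q, a * (b * a) = (a * b) * a := fun a b => by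
    simpa [he] using h a e b
  rw [flex, h]

theorem B15_of_MQ [Nonempty Q] (h : ∀ x y z : Q, (x * y) * (z * x) = (x * (y * z)) * x)
    (x y z : Q) : x * (y * (x * z)) = ((x * y) * x) * z := by
  obtain ⟨e, he⟩ := loop_of_MQ h
  have flex : ∀ a b : Q, a * (b * a) = (a * b) * a := fun a b => by
    simpa [he] using h a e b
  obtain ⟨i, hi⟩ : ∃ i : Q → Q, ∀ a, a * i a = e := ⟨fun a => ldiv a e, fun a => mul_ldiv a e⟩
  have hl : ∀ a b : Q, a * (i a * b) = b := fun a b => by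
    have := h a (i a) b
    rw [hi, (he _).1] at this
    exact (mul_right_cancel this).symm
  have hi' : ∀ a, i a * a = e := fun a => mul_left_cancel ((hl a a).trans (he a).2.symm)
  have ip : InverseProperty e i := .of_left_right he hl fun a b => by
    have := h a b (i a)
    rw [hi', (he _).2, ← flex] at this
    exact (mul_left_cancel this).symm
  have := h x (y * (x * z)) (i (x * z))
  rw [ip.inv_mul, ip.inv_mul_cancel_right, ← ip.inv_mul, ip.mul_inv_cancel_right] at this
  rw [← this, ip.inv_mul_cancel_right]

theorem FQ_of_MQ [Nonempty Q] (h : ∀ x y z : Q, (x * y) * (z * x) = (x * (y * z)) * x)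
    (x y : Q) : x * (y * x) = (x * y) * x := by
  obtain ⟨e, he⟩ := loop_of_MQ h
  simpa [he] using h x e y

theorem LBQ_of_MQ [Nonempty Q] (h : ∀ x y z : Q, (x * y) * (z * x) = (x * (y * z)) * x)
    (x y z : Q) : x * (y * (x * z)) = (x * (y * x)) * z := by
  rw [FQ_of_MQ h, B15_of_MQ h]

theorem LAQ_of_MQ [Nonempty Q] (h : ∀ x y z : Q, (x * y) * (z * x) = (x * (y * z)) * x)
    (x y : Q) : x * (x * y) = (x * x) * y := by
  obtain ⟨e, he⟩ := loop_of_MQ h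
  simpa [he] using B15_of_MQ h x e y

/-! ### Extra quasigroups -/

theorem loop_of_EQ [Nonempty Q] (h : ∀ x y z : Q, x * (y * (z * x)) = ((x * y) * z) * x) :
    ∃ e : Q, ∀ a, e * a = a ∧ a * e = a := by
  obtain ⟨x⟩ := ‹Nonempty Q›
  obtain ⟨e, he⟩ := exists_mul_eq x x
  -- the local right neutral element `e` of `x` is idempotent
  have hee : e * e = e := by
    have h₁ : e * (e * x) = x := by
      have := h x e e
      rw [he, he] at this
      exact mul_left_cancel this
    obtain ⟨s, hs⟩ := exists_mul_eq' e (e * x)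
    obtain ⟨t, rfl⟩ := exists_mul_eq (e * x) s
    have h₂ : t * (e * (e * x)) = e * x := by
      have := h (e * x) t e
      rw [hs] at this
      exact mul_left_cancel this
    rw [h₁] at h₂
    obtain rfl := mul_right_cancel h₂
    have h₃ := h t x t
    rw [hs] at h₃
    exact mul_left_cancel ((mul_left_cancel h₃).trans he.symm)
  have hr : ∀ a, (e * a) * e = a := fun a => by
    obtain ⟨v, rfl⟩ := exists_mul_eq e a
    obtain ⟨w, rfl⟩ := exists_mul_eq' e v
    have h₁ := h e e w
    have h₂ := h e w e
    rw [hee] at h₁ h₂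
    rw [h₁, ← h₂]
  have hl : ∀ a, e * a = a := fun a => by
    obtain ⟨w, rfl⟩ := exists_mul_eq' e a
    have := h e w e
    rwa [hee, hr] at this
  refine ⟨e, fun a => ⟨hl a, ?_⟩⟩
  have := hr a
  rwa [hl] at this

theorem inverseProperty_of_EQ [Nonempty Q]
    (h : ∀ x y z : Q, x * (y * (z * x)) = ((x * y) * z) * x) :
    ∃ (e : Q) (i : Q → Q), InverseProperty e i := by
  obtain ⟨e, he⟩ := loop_of_EQ h
  obtain ⟨i, hi⟩ : ∃ i : Q → Q, ∀ a, a * i a = e := ⟨fun a => ldiv a e, fun a => mul_ldiv a e⟩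
  have hl : ∀ a b : Q, a * (i a * b) = b := fun a b => by
    obtain ⟨z, rfl⟩ := exists_mul_eq' a b
    rw [h, hi, (he _).1]
  have hi' : ∀ a, i a * a = e := fun a => mul_left_cancel ((hl a a).trans (he a).2.symm)
  refine ⟨e, i, .of_left_right he hl fun a b => ?_⟩
  obtain ⟨c, rfl⟩ := exists_mul_eq a b
  rw [← h, hi', (he _).2]

theorem FQ_of_EQ [Nonempty Q] (h : ∀ x y z : Q, x * (y * (z * x)) = ((x * y) * z) * x)
    (x y : Q) : x * (y * x) = (x * y) * x := by
  obtain ⟨e, he⟩ := loop_of_EQ h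
  simpa [he] using h x e y

/-- An extra loop satisfies the conjugated Moufang identity. -/
theorem InverseProperty.mul_mul_inv_of_EQ {e : Q} {i : Q → Q} (ip : InverseProperty e i)
    (h : ∀ x y z : Q, x * (y * (z * x)) = ((x * y) * z) * x) (x y z : Q) :
    (x * y) * (z * i x) = (x * (y * z)) * i x := by
  have := h x y (z * i x)
  rw [ip.inv_mul_cancel_right] at this
  rw [this, ip.mul_inv_cancel_right]

theorem B23_of_EQ [Nonempty Q] (h : ∀ x y z : Q, x * (y * (z * x)) = ((x * y) * z) * x)
    (x y z : Q) : x * ((y * x) * z) = (x * y) * (x * z) := by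
  obtain ⟨e, i, ip⟩ := inverseProperty_of_EQ h
  have := ip.mul_mul_inv_of_EQ h x ((y * x) * z) (i z)
  rw [ip.mul_inv_cancel_right, FQ_of_EQ h, ip.mul_inv_cancel_right, ← ip.inv_mul] at this
  rw [← this, ip.inv_mul_cancel_right]

/-- The mirror image of the identity `B15`. -/
theorem E15_of_EQ [Nonempty Q] (h : ∀ x y z : Q, x * (y * (z * x)) = ((x * y) * z) * x)
    (x y z : Q) : x * (y * (z * y)) = ((x * y) * z) * y := by
  obtain ⟨e, i, ip⟩ := inverseProperty_of_EQ h
  have h₁ : ∀ a, y * (a * i y) = (y * a) * i y := fun a => by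
    simpa [ip.one_mul, ip.mul_one] using ip.mul_mul_inv_of_EQ h y e a
  have h₂ := B23_of_EQ h y x (i y * (((y * z) * y) * i y))
  rw [ip.mul_inv_cancel_left, ip.mul_inv_cancel_right, ip.inv_mul_cancel_left] at h₂
  have h₃ := ip.mul_mul_inv_of_EQ h y x ((y * z) * y)
  rw [ip.mul_inv_cancel_right, ← h₁, ← h₂] at h₃
  rw [mul_left_cancel h₃, ip.inv_mul_cancel_right, FQ_of_EQ h]

/-- Extra quasigroups are Moufang. -/
theorem MQ_of_EQ [Nonempty Q] (h : ∀ x y z : Q, x * (y * (z * x)) = ((x * y) * z) * x)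
    (x y z : Q) : (x * y) * (z * x) = (x * (y * z)) * x := by
  obtain ⟨e, i, ip⟩ := inverseProperty_of_EQ h
  have := E15_of_EQ h (i (x * y)) x (y * z)
  rw [ip.inv_mul, ip.inv_mul_cancel_right, ip.inv_mul_cancel_left, ← ip.inv_mul] at this
  rw [← this, ip.mul_inv_cancel_left, FQ_of_EQ h]

theorem LC2_of_EQ [Nonempty Q] (h : ∀ x y z : Q, x * (y * (z * x)) = ((x * y) * z) * x)
    (x y z : Q) : x * (x * (y * z)) = (x * (x * y)) * z := by
  obtain ⟨v, rfl⟩ := exists_mul_eq' x z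
  rw [MQ_of_EQ h, ← FQ_of_EQ h, ← h]

theorem LC1_of_EQ [Nonempty Q] (h : ∀ x y z : Q, x * (y * (z * x)) = ((x * y) * z) * x)
    (x y z : Q) : (x * x) * (y * z) = (x * (x * y)) * z := by
  rw [← LC2_of_EQ h, LAQ_of_MQ (MQ_of_EQ h)]

theorem CQ_of_EQ [Nonempty Q] (h : ∀ x y z : Q, x * (y * (z * x)) = ((x * y) * z) * x)
    (x y z : Q) : x * (y * (y * z)) = ((x * y) * y) * z := by
  obtain ⟨e, he⟩ := loop_of_EQ h
  have := E15_of_EQ h x y e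
  rw [(he _).1, (he _).2] at this
  rw [LC4_of_LC1 (LC1_of_EQ h), this]

/-- Local right neutral elements are left neutral for the same element (`h₁`) and idempotent (`h₃`),
and left translation by an idempotent is the identity. -/
theorem loop_of_B23 [Nonempty Q] (h : ∀ x y z : Q, x * ((y * x) * z) = (x * y) * (x * z)) :
    ∃ e : Q, ∀ a, e * a = a ∧ a * e = a := by
  have h₁ : ∀ x e : Q, x * e = x → e * x = x := fun x e he => by
    have := h x e x
    rw [he] at this
    exact mul_right_cancel (mul_left_cancel this)
  have h₂ : ∀ x y t e : Q, x * e = x → (x * y) * t = x → t * y = e := fun x y t e he ht => by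
    have h₃ := h y x t
    rw [ht] at h₃
    have h₄ := h y t x
    rw [h₁ _ _ h₃.symm] at h₄
    exact mul_right_cancel ((mul_left_cancel h₄).trans (h₁ x e he).symm)
  have h₃ : ∀ x e : Q, x * e = x → e * e = e := fun x e he => by
    have hex := h₁ x e he
    have h₄ := h e x x
    rw [he, hex] at h₄
    obtain ⟨w, hw⟩ := exists_mul_eq x e
    have h₅ := h x w x
    rw [hw, h₄] at h₅
    have hwx : w * x = e := mul_right_cancel ((mul_left_cancel h₅).trans hex.symm)
    have h₆ := h x w e
    rw [hw, hwx, he, hex] at h₆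
    exact mul_left_cancel (h₆.trans he.symm)
  obtain ⟨x⟩ := ‹Nonempty Q›
  obtain ⟨e, he⟩ := exists_mul_eq x x
  have hee := h₃ x e he
  have hl : ∀ a, e * a = a := fun a => by
    obtain ⟨b, hb⟩ := exists_mul_eq a e
    have ha : (e * b) * a = e := by
      obtain ⟨t, ht⟩ := exists_mul_eq (e * b) e
      have := h₂ e b t e hee ht
      rwa [mul_right_cancel (this.trans hb.symm)] at ht
    obtain ⟨g, hg⟩ := exists_mul_eq (e * b) (e * b)
    have hba : b * a = g := h₂ (e * b) a b g hg (by rw [ha])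
    have := h b a a
    rw [hb, hba] at this
    exact mul_left_cancel (this.trans ((h₃ _ g hg).trans hba.symm))
  refine ⟨e, fun a => ⟨hl a, ?_⟩⟩
  obtain ⟨g, hg⟩ := exists_mul_eq a a
  rwa [← mul_right_cancel ((h₁ a g hg).trans (hl a).symm)]

/-- Inversion is an antiautomorphism, so `B23` can be rewritten as the conjugated identity `key`,
from which `EQ` follows. -/
theorem EQ_of_B23 [Nonempty Q] (h : ∀ x y z : Q, x * ((y * x) * z) = (x * y) * (x * z))
    (x y z : Q) : x * (y * (z * x)) = ((x * y) * z) * x := by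
  obtain ⟨e, he⟩ := loop_of_B23 h
  obtain ⟨i, hi'⟩ : ∃ i : Q → Q, ∀ a, i a * a = e := ⟨fun a => rdiv e a, fun a => rdiv_mul a e⟩
  have hi : ∀ a, a * i a = e := fun a => by
    have := h a (i a) e
    rw [hi', (he _).1] at this
    exact (mul_right_cancel ((he _).1.trans this)).symm
  have hr : ∀ a b : Q, (b * a) * i a = b := fun a b => by
    have := h a b (i a)
    rw [hi, (he _).2] at this
    exact mul_left_cancel this
  have hr' : ∀ a b : Q, (b * i a) * a = b := fun a b => mul_right_cancel (hr a (b * i a))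
  have hii : ∀ a, i (i a) = a := fun a => mul_right_cancel ((hi' (i a)).trans (hi a).symm)
  have hm : ∀ a b, i (a * b) = i b * i a := fun a b => by
    have h₁ := h a (i b * i a) b
    rw [hr', hi', (he _).2] at h₁
    have h₂ := hr (a * b) (a * (i b * i a))
    rw [← h₁] at h₂
    exact mul_left_cancel h₂
  have key : ∀ x y z : Q, x * ((y * z) * i x) = (x * y) * (z * i x) := fun x y z => by
    have h₁ := h x ((y * z) * i x) (i z)
    rw [hr', hr] at h₁
    have h₂ : z * i x = i (x * i z) := by rw [hm, hii]
    rw [h₁, h₂, hr]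
  have h₁ := key x y (z * x)
  have h₂ := key x (y * (z * x)) e
  rw [(he _).2, (he _).1] at h₂
  rw [hr, h₂] at h₁
  rw [← h₁, hr']

end Algebra

/-! ### Equivalent identities -/

theorem holdsIn_bm_of_GR {Q : Type u} [Mul Q] (h : ∀ x y z : Q, x * (y * z) = (x * y) * z)
    (X : Word) (i j : Bracketing) : (bm X i j).HoldsIn Q := by
  have key : ∀ (v : Fin 3 → Q) (i : Bracketing) (s t u w : Term),
      FreeMagma.lift v (i.apply s t u w) = FreeMagma.lift v (Bracketing.b5.apply s t u w) := by
    intro v i s t u w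
    cases i <;> simp only [Bracketing.apply, map_mul, h]
  intro a b c
  cases X <;> exact (key _ i _ _ _ _).trans (key _ j _ _ _ _).symm

open VarietyName in
/-- Identities of Bol-Moufang type that define one of the varieties, without being its defining
identity. Up to renaming and duality, there are no others. -/
def alternativeIdentities : List (VarietyName × Identity) :=
  [(GR, bm .A .b1 .b2), (GR, bm .A .b2 .b4), (GR, bm .B .b1 .b2), (GR, bm .B .b1 .b3),
   (GR, bm .B .b2 .b4), (GR, bm .B .b3 .b4), (GR, bm .B .b3 .b5), (GR, bm .C .b1 .b3),
   (GR, bm .C .b2 .b3), (GR, bm .D .b1 .b2), (GR, bm .D .b1 .b3),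
   (RG1, bm .D .b2 .b5), (EQ, bm .B .b2 .b3), (MQ, bm .B .b1 .b5),
   (LAQ, bm .A .b1 .b3), (LAQ, bm .A .b4 .b5), (LAQ, bm .C .b1 .b2),
   (FQ, bm .B .b4 .b5), (FQ, bm .D .b2 .b4)]

/-- Every listed identity is, up to renaming, the defining identity, the mirror image of the
defining identity of the dual variety, or an alternative identity or its mirror image. -/
theorem equivalentIdentities_cases : ∀ V : VarietyName, ∀ I ∈ V.equivalentIdentities,
    I.SameUpToRenaming V.definingIdentity ∨ I.SameUpToRenaming V.dual.definingIdentity.dual ∨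
    ∃ p ∈ alternativeIdentities,
      (p.1 = V ∧ I.SameUpToRenaming p.2) ∨ (p.1 = V.dual ∧ I.SameUpToRenaming p.2.dual) := by
  decide +kernel

section
variable {Q : Type u} [Quasigroup Q] [Nonempty Q]

theorem holdsIn_alternative : ∀ p ∈ alternativeIdentities,
    p.2.HoldsIn Q ↔ p.1.definingIdentity.HoldsIn Q := by
  simp only [alternativeIdentities, List.forall_mem_cons, List.not_mem_nil, false_imp_iff,
    implies_true, and_true]
  refine ⟨⟨fun h x y z => ?_, fun h => holdsIn_bm_of_GR h _ _ _⟩,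
    ⟨fun h x y z => ?_, fun h => holdsIn_bm_of_GR h _ _ _⟩,
    ⟨fun h x y z => ?_, fun h => holdsIn_bm_of_GR h _ _ _⟩,
    ⟨fun h x y z => ?_, fun h => holdsIn_bm_of_GR h _ _ _⟩,
    ⟨fun h x y z => ?_, fun h => holdsIn_bm_of_GR h _ _ _⟩,
    ⟨fun h => GR_of_B34 h, fun h => holdsIn_bm_of_GR h _ _ _⟩,
    ⟨fun h x y z => ?_, fun h => holdsIn_bm_of_GR h _ _ _⟩,
    ⟨fun h x y z => ?_, fun h => holdsIn_bm_of_GR h _ _ _⟩,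
    ⟨fun h => GR_of_C23 h, fun h => holdsIn_bm_of_GR h _ _ _⟩,
    ⟨fun h x y z => ?_, fun h => holdsIn_bm_of_GR h _ _ _⟩,
    ⟨fun h x y z => ?_, fun h => holdsIn_bm_of_GR h _ _ _⟩,
    ⟨fun h x y z => rebracket_of_D25 h _ _ _ _, fun h x y z => rebracket_of_A25 h _ _ _ _⟩,
    ⟨fun h => EQ_of_B23 h, fun h => B23_of_EQ h⟩, ⟨fun h => MQ_of_B15 h, fun h => B15_of_MQ h⟩,
    ⟨fun h x y z => ?_, fun h x y z => h x (y * z) y⟩,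
    ⟨fun h x y z => ?_, fun h x y z => congrArg (· * z) (h x y y)⟩,
    ⟨fun h x y z => ?_, fun h x y z => congrArg (x * ·) (h y z z)⟩,
    ⟨fun h x y z => ?_, fun h x y z => congrArg (· * z) (h x y y)⟩,
    ⟨fun h x y z => ?_, fun h x y z => h x (y * z) y⟩⟩
  · exact mul_left_cancel (h x y z)
  · obtain ⟨y, rfl⟩ := exists_mul_eq x y
    exact h x y z
  · exact mul_left_cancel (h y x z)
  · obtain ⟨z, rfl⟩ := exists_mul_eq x z
    exact h x y z
  · obtain ⟨y, rfl⟩ := exists_mul_eq' x y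
    exact h x y z
  · obtain ⟨x, rfl⟩ := exists_mul_eq y x
    exact h y x z
  · obtain ⟨z, rfl⟩ := exists_mul_eq y z
    exact h x y z
  · exact mul_left_cancel (h z x y)
  · obtain ⟨z, rfl⟩ := exists_mul_eq' x z
    exact h x y z
  · obtain ⟨y, rfl⟩ := exists_mul_eq x y
    exact h x x y
  · exact mul_right_cancel (h x y z)
  · exact mul_left_cancel (h x x y)
  · exact mul_right_cancel (h x y z)
  · obtain ⟨y, rfl⟩ := exists_mul_eq x y
    exact h x x y

end

theorem VarietyName.mem_variety {V : VarietyName} {Q : QuasigroupObj.{u}} :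
    Q ∈ V.variety ↔ V.definingIdentity.HoldsIn Q.carrier :=
  Identity.mem_models

/-- The mirror image of the defining identity of `V` defines the dual variety. -/
theorem VarietyName.models_definingIdentity_dual (V : VarietyName) :
    V.definingIdentity.dual.models = (V.dual.variety : Set QuasigroupObj.{u}) := by
  by_cases hV : V = .MQ
  · subst hV
    ext Q
    rw [VarietyName.mem_variety, Identity.mem_models, ← Identity.holdsIn_op]
    have : Nonempty Q.carrierᵐᵒᵖ := Q.nonempty.map op
    constructor
    · intro h x y z
      exact congrArg unop (D23_of_MQ (Q := Q.carrierᵐᵒᵖ) h (op x) (op z) (op y)).symm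
    · intro h x y z
      exact congrArg op (D23_of_MQ (Q := Q.carrier) h (unop x) (unop z) (unop y)).symm
  · exact (V.definingIdentity_dual hV).models_eq.symm

theorem VarietyName.opposite_mem_variety {V : VarietyName} {Q : QuasigroupObj.{u}} :
    Q.opposite ∈ V.variety ↔ Q ∈ V.dual.variety := by
  rw [← V.models_definingIdentity_dual]
  exact Identity.opposite_mem_models

theorem VarietyName.models_eq_variety {V : VarietyName} {I : Identity}
    (hI : I ∈ V.equivalentIdentities) : I.models = (V.variety : Set QuasigroupObj.{u}) := by
  rcases equivalentIdentities_cases V I hI with h | h | ⟨⟨W, J⟩, hJ, ⟨rfl, h⟩ | ⟨hW, h⟩⟩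
  · exact h.models_eq
  · rw [h.models_eq, models_definingIdentity_dual, dual_dual]
  · ext Q
    rw [h.models_eq, mem_variety, Identity.mem_models]
    exact holdsIn_alternative _ hJ
  · ext Q
    obtain rfl : W = V.dual := hW
    rw [h.models_eq, ← Identity.opposite_mem_models, ← V.dual_dual, ← opposite_mem_variety,
      V.dual_dual, mem_variety, Identity.mem_models]
    exact holdsIn_alternative _ hJ

/-! ### Inclusions -/

open VarietyName in
/-- The inclusions of the Hasse diagram, up to duality. -/
def inclusions : List (VarietyName × VarietyName) :=
  [(GR, RG1), (GR, RG2), (GR, EQ), (RG1, RG3), (RG1, RC4), (RG1, RBQ), (EQ, LC1), (EQ, MQ),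
   (EQ, CQ), (MQ, LBQ), (MQ, LAQ), (MQ, FQ), (LC1, LC4), (LC1, LC3), (LC1, LNQ), (LC1, LAQ),
   (LC1, MNQ), (LC4, LC2)]

theorem upperCovers_cases : ∀ V : VarietyName, ∀ W ∈ V.upperCovers,
    (V, W) ∈ inclusions ∨ (V.dual, W.dual) ∈ inclusions := by
  decide +kernel

theorem holdsIn_of_mem_inclusions {Q : Type u} [Quasigroup Q] [Nonempty Q] :
    ∀ p ∈ inclusions, p.1.definingIdentity.HoldsIn Q → p.2.definingIdentity.HoldsIn Q := by
  simp only [inclusions, List.forall_mem_cons, List.not_mem_nil, false_imp_iff,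
    implies_true, and_true]
  exact ⟨fun h => holdsIn_bm_of_GR h .A .b2 .b5, fun h => holdsIn_bm_of_GR h .A .b2 .b3,
    fun h => holdsIn_bm_of_GR h .D .b1 .b5,
    fun h x y z => rebracket_of_A25 h _ _ _ _, fun h x y z => rebracket_of_A25 h _ _ _ _,
    fun h x y z => rebracket_of_A25 h _ _ _ _, fun h => LC1_of_EQ h, fun h => MQ_of_EQ h,
    fun h => CQ_of_EQ h, fun h => LBQ_of_MQ h, fun h x y _ => LAQ_of_MQ h x y,
    fun h x y _ => FQ_of_MQ h x y, fun h => LC4_of_LC1 h, fun h => LC3_of_LC1 h,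
    fun h => LNQ_of_LC1 h, fun h x y _ => LAQ_of_LC1 h x y, fun h => MNQ_of_LC1 h,
    fun h => LC2_of_LC4 h⟩

theorem VarietyName.variety_subset_of_mem_upperCovers {V W : VarietyName}
    (h : W ∈ V.upperCovers) : V.variety ⊆ (W.variety : Set QuasigroupObj.{u}) := by
  intro Q hQ
  rcases upperCovers_cases V W h with h | h
  · rw [mem_variety] at hQ ⊢
    exact holdsIn_of_mem_inclusions _ h hQ
  · rw [← V.dual_dual, ← opposite_mem_variety, mem_variety] at hQ
    rw [← W.dual_dual, ← opposite_mem_variety, mem_variety]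
    exact holdsIn_of_mem_inclusions (Q := Q.opposite.carrier) _ h hQ

theorem VarietyName.Below.variety_subset {V W : VarietyName} (h : V.Below W) :
    V.variety ⊆ (W.variety : Set QuasigroupObj.{u}) := by
  induction h with
  | refl => exact subset_rfl
  | tail _ h ih => exact ih.trans (variety_subset_of_mem_upperCovers h)

/-! ### Neutral elements -/

open VarietyName in
/-- The varieties whose members all have a left, but not always a right, neutral element. -/
def varietiesOfLeftLoops : List VarietyName := [RG1, RG2, RG3, RBQ, RC4, LC3, LAQ, LNQ]

theorem isLeftLoop_of_mem {V : VarietyName} (hV : V ∈ varietiesOfLeftLoops) {Q : QuasigroupObj.{u}}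
    (hQ : Q ∈ V.variety) : IsLeftLoop Q := by
  rw [VarietyName.mem_variety] at hQ
  revert hQ
  revert V
  simp only [varietiesOfLeftLoops, List.forall_mem_cons, List.not_mem_nil, false_imp_iff,
    implies_true, and_true]
  exact ⟨fun h => leftLoop_of_A25 h, fun h => leftLoop_of_RG2 h, fun h => leftLoop_of_RG3 h,
    fun h => leftLoop_of_RBQ h, fun h => leftLoop_of_RC4 h, fun h => leftLoop_of_LC3 h,
    fun h => leftLoop_of_LAQ fun x y => h x y y, fun h => leftLoop_of_LNQ h⟩

theorem isRightLoop_of_mem {V : VarietyName} (hV : V.dual ∈ varietiesOfLeftLoops)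
    {Q : QuasigroupObj.{u}} (hQ : Q ∈ V.variety) : IsRightLoop Q := by
  rw [← V.dual_dual, ← VarietyName.opposite_mem_variety] at hQ
  exact isLeftLoop_opposite.1 (isLeftLoop_of_mem hV hQ)

theorem isLoop_of_mem {V : VarietyName} (hV : V ∈ ([.MQ, .EQ, .LC1, .MNQ] : List VarietyName))
    {Q : QuasigroupObj.{u}} (hQ : Q ∈ V.variety) : IsLoop Q := by
  rw [VarietyName.mem_variety] at hQ
  revert hQ
  revert V
  simp only [List.forall_mem_cons, List.not_mem_nil, false_imp_iff, implies_true, and_true]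
  exact ⟨fun h => loop_of_MQ h, fun h => loop_of_EQ h, fun h => loop_of_LC1 h,
    fun h => loop_of_MNQ h⟩

/-! ### Finite models -/

instance (I : Identity) {α : Type*} [Mul α] [Fintype α] [DecidableEq α] : Decidable (I.HoldsIn α) :=
  inferInstanceAs (Decidable (∀ _ _ _ : α, _ = _))

/-- A finite set with a cancellative operation is a quasigroup: translations are injective, hence
bijective. It is lifted to the universe under consideration. -/
noncomputable def QuasigroupObj.ofIsCancelMul (α : Type) [Mul α] [IsCancelMul α] [Finite α]
    [Nonempty α] : QuasigroupObj.{u} where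
  carrier := ULift.{u} α
  str :=
    have hl (a : α) : Function.Surjective (a * ·) :=
      Finite.surjective_of_injective (mul_right_injective a)
    have hr (a : α) : Function.Surjective (· * a) :=
      Finite.surjective_of_injective (mul_left_injective a)
    { mul := (· * ·)
      ldiv := fun a b => ⟨Function.surjInv (hl a.down) b.down⟩
      rdiv := fun b a => ⟨Function.surjInv (hr a.down) b.down⟩
      mul_ldiv := fun a b => congrArg ULift.up (Function.surjInv_eq (hl a.down) b.down)
      rdiv_mul := fun a b => congrArg ULift.up (Function.surjInv_eq (hr a.down) b.down)
      ldiv_mul := fun a b => congrArg ULift.up <| mul_left_cancel <|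
        Function.surjInv_eq (hl a.down) (a.down * b.down)
      mul_rdiv := fun a b => congrArg ULift.up <| mul_right_cancel <|
        Function.surjInv_eq (hr a.down) (b.down * a.down) }

theorem down_lift {α : Type} [Mul α] (v : Fin 3 → ULift.{u} α) (t : Term) :
    (FreeMagma.lift v t).down = FreeMagma.lift (fun i => (v i).down) t := by
  induction t using FreeMagma.recOnMul with
  | ih1 i => rfl
  | ih2 s t hs ht => rw [map_mul, map_mul, ← hs, ← ht]; rfl

theorem Identity.ofIsCancelMul_mem_models {I : Identity} {α : Type} [Mul α] [IsCancelMul α]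
    [Finite α] [Nonempty α] :
    QuasigroupObj.ofIsCancelMul.{u} α ∈ I.models ↔ I.HoldsIn α := by
  have key (v : Fin 3 → ULift.{u} α) :
      FreeMagma.lift v I.lhs = FreeMagma.lift v I.rhs ↔
        FreeMagma.lift (fun i => (v i).down) I.lhs =
          FreeMagma.lift (fun i => (v i).down) I.rhs := by
    rw [← ULift.down_inj, down_lift, down_lift]
  exact ⟨fun h a b c => (key fun i => ⟨![a, b, c] i⟩).1 (h _), fun h v => (key v).2 (h.lift_eq _)⟩

/-- The elements of a groupoid on `Fin n` that is given by its multiplication table. -/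
def Table {n : ℕ} (_T : Matrix (Fin n) (Fin n) (Fin n)) : Type := Fin n

namespace Table

variable {n : ℕ} (T : Matrix (Fin n) (Fin n) (Fin n))

instance : Mul (Table T) := ⟨T⟩
instance : Fintype (Table T) := inferInstanceAs (Fintype (Fin n))
instance : DecidableEq (Table T) := inferInstanceAs (DecidableEq (Fin n))
instance [NeZero n] : Nonempty (Table T) := inferInstanceAs (Nonempty (Fin n))

end Table

/-- All varieties that can be reached from `V` by at most `k` edges of the Hasse diagram. -/
def VarietyName.reachable : ℕ → VarietyName → List VarietyName
  | 0, V => [V]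
  | k + 1, V => V :: V.upperCovers.flatMap (reachable k)

/-- The varieties that contain `V`, according to the Hasse diagram, whose chains have at most four
edges. -/
def VarietyName.above (V : VarietyName) : List VarietyName := reachable 4 V

theorem VarietyName.below_of_mem_reachable : ∀ {k : ℕ} {V W : VarietyName},
    W ∈ reachable k V → V.Below W
  | 0, V, W, h => by
    rw [reachable, List.mem_singleton] at h
    exact h ▸ .refl
  | k + 1, V, W, h => by
    rw [reachable, List.mem_cons, List.mem_flatMap] at h
    rcases h with rfl | ⟨X, hX, h⟩
    · exact .refl
    · exact .head hX (below_of_mem_reachable h)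

theorem VarietyName.below_of_mem_above {V W : VarietyName} (h : W ∈ V.above) : V.Below W :=
  below_of_mem_reachable h

/-- `α` is a cancellative groupoid in `V` that is in no variety outside the list `L`. -/
def IsSeparating (α : Type) [Mul α] (V : VarietyName) (L : List VarietyName) : Prop :=
  ((∀ a b c : α, a * b = a * c → b = c) ∧ ∀ a b c : α, a * b = c * b → a = c) ∧
    V.definingIdentity.HoldsIn α ∧ ∀ W : VarietyName, W ∈ L ∨ ¬ W.definingIdentity.HoldsIn α

instance (α : Type) [Mul α] [Fintype α] [DecidableEq α] (V : VarietyName) (L : List VarietyName) :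
    Decidable (IsSeparating α V L) :=
  inferInstanceAs (Decidable ((_ ∧ _) ∧ _ ∧ _))

theorem IsSeparating.exists_mem {α : Type} [Mul α] [Finite α] [Nonempty α] {V : VarietyName}
    {L : List VarietyName} (h : IsSeparating α V L) :
    ∃ Q ∈ VarietyName.variety.{u} V, (∀ W ∉ L, Q ∉ W.variety) ∧
      ((∀ e : α, ∃ a, e * a ≠ a) → ¬ IsLeftLoop Q) ∧
      ((∀ e : α, ∃ a, a * e ≠ a) → ¬ IsRightLoop Q) := by
  obtain ⟨⟨hl, hr⟩, hV, hL⟩ := h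
  have : IsCancelMul α :=
    { mul_left_cancel := fun a _ _ => hl a _ _
      mul_right_cancel := fun a _ _ => hr _ a _ }
  refine ⟨QuasigroupObj.ofIsCancelMul α, Identity.ofIsCancelMul_mem_models.2 hV,
    fun W hW hQ => (hL W).elim hW fun h => h (Identity.ofIsCancelMul_mem_models.1 hQ), ?_, ?_⟩
  · rintro h ⟨⟨e⟩, he⟩
    obtain ⟨a, ha⟩ := h e
    exact ha (congrArg ULift.down (he ⟨a⟩))
  · rintro h ⟨⟨e⟩, he⟩
    obtain ⟨a, ha⟩ := h e
    exact ha (congrArg ULift.down (he ⟨a⟩))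

/-- A left loop without right neutral element. -/
def tableRG1 : Matrix (Fin 6) (Fin 6) (Fin 6) :=
  !![0, 1, 2, 3, 4, 5; 5, 2, 1, 4, 3, 0; 4, 3, 0, 5, 2, 1; 3, 4, 5, 0, 1, 2; 2, 5, 4, 1, 0, 3;
     1, 0, 3, 2, 5, 4]

theorem isSeparating_tableRG1 : IsSeparating (Table tableRG1) .RG1 (VarietyName.above .RG1) := by
  decide +kernel

/-- The quasigroup with product `2x + y` on the integers modulo 5, a left loop without right neutral
element. -/
def tableRG2 : Matrix (Fin 5) (Fin 5) (Fin 5) :=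
  !![0, 1, 2, 3, 4; 2, 3, 4, 0, 1; 4, 0, 1, 2, 3; 1, 2, 3, 4, 0; 3, 4, 0, 1, 2]

theorem isSeparating_tableRG2 : IsSeparating (Table tableRG2) .RG2 (VarietyName.above .RG2) := by
  decide +kernel

/-- A left loop without right neutral element. -/
def tableRG3 : Matrix (Fin 6) (Fin 6) (Fin 6) :=
  !![0, 1, 2, 3, 4, 5; 3, 4, 5, 0, 1, 2; 2, 5, 0, 4, 3, 1; 1, 0, 4, 5, 2, 3; 4, 3, 1, 2, 5, 0;
     5, 2, 3, 1, 0, 4]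

theorem isSeparating_tableRG3 : IsSeparating (Table tableRG3) .RG3 (VarietyName.above .RG3) := by
  decide +kernel

/-- A left loop without right neutral element. -/
def tableRBQ : Matrix (Fin 8) (Fin 8) (Fin 8) :=
  !![0, 1, 2, 3, 4, 5, 6, 7; 7, 5, 6, 4, 0, 1, 2, 3; 4, 6, 5, 7, 3, 2, 1, 0;
     3, 2, 1, 0, 7, 6, 5, 4; 2, 0, 3, 1, 6, 7, 4, 5; 6, 7, 4, 5, 1, 0, 3, 2;
     5, 4, 7, 6, 2, 3, 0, 1; 1, 3, 0, 2, 5, 4, 7, 6]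

theorem isSeparating_tableRBQ : IsSeparating (Table tableRBQ) .RBQ (VarietyName.above .RBQ) := by
  decide +kernel

/-- A quasigroup without left or right neutral element. -/
def tableRC2 : Matrix (Fin 5) (Fin 5) (Fin 5) :=
  !![0, 3, 1, 2, 4; 2, 4, 0, 3, 1; 1, 2, 4, 0, 3; 4, 0, 3, 1, 2; 3, 1, 2, 4, 0]

theorem isSeparating_tableRC2 : IsSeparating (Table tableRC2) .RC2 (VarietyName.above .RC2) := by
  decide +kernel

/-- A left loop without right neutral element. -/
def tableRC4 : Matrix (Fin 6) (Fin 6) (Fin 6) :=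
  !![2, 3, 4, 5, 1, 0; 4, 2, 5, 0, 3, 1; 0, 1, 2, 3, 4, 5; 5, 0, 3, 1, 2, 4; 1, 4, 0, 2, 5, 3;
     3, 5, 1, 4, 0, 2]

theorem isSeparating_tableRC4 : IsSeparating (Table tableRC4) .RC4 (VarietyName.above .RC4) := by
  decide +kernel

/-- A left loop without right neutral element. -/
def tableLC3 : Matrix (Fin 5) (Fin 5) (Fin 5) :=
  !![3, 2, 4, 1, 0; 1, 4, 0, 2, 3; 0, 1, 2, 3, 4; 4, 3, 1, 0, 2; 2, 0, 3, 4, 1]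

/-- The model also satisfies `RG2`; a member of `LC1` separates `LC3` from `RG2`. -/
theorem isSeparating_tableLC3 :
    IsSeparating (Table tableLC3) .LC3 (.RG2 :: VarietyName.above .LC3) := by
  decide +kernel

/-- A left loop without right neutral element. -/
def tableLAQ : Matrix (Fin 6) (Fin 6) (Fin 6) :=
  !![3, 4, 5, 0, 1, 2; 1, 5, 3, 4, 2, 0; 2, 3, 1, 5, 0, 4; 0, 1, 2, 3, 4, 5; 4, 2, 0, 1, 5, 3;
     5, 0, 4, 2, 3, 1]

theorem isSeparating_tableLAQ : IsSeparating (Table tableLAQ) .LAQ (VarietyName.above .LAQ) := by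
  decide +kernel

/-- A left loop without right neutral element. -/
def tableLNQ : Matrix (Fin 5) (Fin 5) (Fin 5) :=
  !![0, 1, 2, 3, 4; 1, 0, 3, 4, 2; 3, 4, 0, 2, 1; 4, 2, 1, 0, 3; 2, 3, 4, 1, 0]

theorem isSeparating_tableLNQ : IsSeparating (Table tableLNQ) .LNQ (VarietyName.above .LNQ) := by
  decide +kernel

/-- A quasigroup without left or right neutral element. -/
def tableCQ : Matrix (Fin 8) (Fin 8) (Fin 8) :=
  !![3, 4, 5, 1, 0, 6, 7, 2; 7, 5, 4, 2, 6, 0, 3, 1; 5, 7, 3, 6, 2, 1, 4, 0;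
     6, 0, 1, 4, 5, 7, 2, 3; 0, 6, 2, 5, 4, 3, 1, 7; 1, 2, 6, 7, 3, 4, 0, 5;
     4, 3, 7, 0, 1, 2, 5, 6; 2, 1, 0, 3, 7, 5, 6, 4]

theorem isSeparating_tableCQ : IsSeparating (Table tableCQ) .CQ (VarietyName.above .CQ) := by
  decide +kernel

/-- A quasigroup without left or right neutral element. -/
def tableFQ : Matrix (Fin 5) (Fin 5) (Fin 5) :=
  !![2, 4, 3, 1, 0; 4, 0, 2, 3, 1; 3, 2, 1, 0, 4; 1, 3, 0, 4, 2; 0, 1, 4, 2, 3]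

theorem isSeparating_tableFQ : IsSeparating (Table tableFQ) .FQ (VarietyName.above .FQ) := by
  decide +kernel

/-- A loop. -/
def tableMNQ : Matrix (Fin 6) (Fin 6) (Fin 6) :=
  !![0, 1, 2, 3, 4, 5; 1, 0, 4, 5, 3, 2; 2, 3, 5, 4, 0, 1; 3, 5, 1, 0, 2, 4; 4, 2, 0, 1, 5, 3;
     5, 4, 3, 2, 1, 0]

theorem isSeparating_tableMNQ : IsSeparating (Table tableMNQ) .MNQ (VarietyName.above .MNQ) := by
  decide +kernel

/-- A loop. -/
def tableLC1 : Matrix (Fin 12) (Fin 12) (Fin 12) :=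
  !![0, 1, 2, 3, 4, 5, 6, 7, 8, 9, 10, 11; 1, 0, 7, 8, 11, 6, 5, 2, 3, 10, 9, 4;
     2, 7, 4, 5, 1, 9, 10, 11, 6, 8, 3, 0; 3, 10, 5, 0, 6, 2, 4, 9, 11, 7, 1, 8;
     4, 11, 1, 9, 7, 8, 3, 0, 10, 6, 5, 2; 5, 9, 3, 1, 8, 4, 2, 10, 7, 11, 0, 6;
     6, 8, 10, 7, 9, 11, 0, 3, 1, 4, 2, 5; 7, 2, 11, 6, 0, 10, 9, 4, 5, 3, 8, 1;
     8, 6, 9, 11, 10, 7, 1, 5, 0, 2, 4, 3; 9, 5, 8, 4, 3, 1, 7, 6, 2, 0, 11, 10;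
     10, 3, 6, 2, 5, 0, 11, 8, 4, 1, 7, 9; 11, 4, 0, 10, 2, 3, 8, 1, 9, 5, 6, 7]

theorem isSeparating_tableLC1 : IsSeparating (Table tableLC1) .LC1 (VarietyName.above .LC1) := by
  decide +kernel

/-- The Chein double `G ∪ Gu` of a group `G`, the standard source of nonassociative Moufang loops:
`(g, false)` stands for `g`, and `(g, true)` for `gu`. -/
def Chein (G : Type) : Type := G × Bool

namespace Chein

variable (G : Type)

/-- The product, with `g(hu) = (hg)u`, `(gu)h = (gh⁻¹)u` and `(gu)(hu) = h⁻¹g`. -/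
instance [Group G] : Mul (Chein G) where
  mul
    | (g, false), (h, false) => (g * h, false)
    | (g, false), (h, true) => (h * g, true)
    | (g, true), (h, false) => (g * h⁻¹, true)
    | (g, true), (h, true) => (h⁻¹ * g, false)

instance [Fintype G] : Fintype (Chein G) := inferInstanceAs (Fintype (G × Bool))
instance [DecidableEq G] : DecidableEq (Chein G) := inferInstanceAs (DecidableEq (G × Bool))
instance [Nonempty G] : Nonempty (Chein G) := inferInstanceAs (Nonempty (G × Bool))

end Chein

theorem isSeparating_chein_dihedralGroup_three :
    IsSeparating (Chein (DihedralGroup 3)) .MQ (VarietyName.above .MQ) := by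
  decide +kernel

theorem isSeparating_chein_dihedralGroup_four :
    IsSeparating (Chein (DihedralGroup 4)) .EQ (VarietyName.above .EQ) := by
  decide +kernel

/-! ### Non-inclusions -/

open VarietyName in
/-- Together with `GR`, one variety from each pair of dual varieties, and the self-dual ones. -/
def representatives : List VarietyName :=
  [RG1, RG2, RG3, RBQ, RC2, RC4, LC3, LAQ, LNQ, CQ, FQ, MNQ, LC1, MQ, EQ]

theorem VarietyName.mem_representatives : ∀ V : VarietyName,
    V = .GR ∨ V ∈ representatives ∨ V.dual ∈ representatives := by
  decide

theorem VarietyName.mem_above_GR : ∀ V : VarietyName, V ∈ VarietyName.GR.above := by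
  decide

theorem VarietyName.mem_above_dual : ∀ V W : VarietyName, W.dual ∈ V.dual.above → W ∈ V.above := by
  decide +kernel

theorem VarietyName.above_antisymm : ∀ V W : VarietyName, W ∈ V.above → V ∈ W.above → V = W := by
  decide +kernel

theorem exists_mem_notMem_of_mem_representatives : ∀ V ∈ representatives, ∀ W ∉ V.above,
    ∃ Q ∈ VarietyName.variety.{u} V, Q ∉ W.variety := by
  have key {α : Type} [Mul α] [Finite α] [Nonempty α] {V : VarietyName}
      (h : IsSeparating α V V.above) :
      ∀ W ∉ V.above, ∃ Q ∈ VarietyName.variety.{u} V, Q ∉ W.variety := by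
    intro W hW
    obtain ⟨Q, hQ, h, -⟩ := h.exists_mem
    exact ⟨Q, hQ, h W hW⟩
  simp only [representatives, List.forall_mem_cons, List.not_mem_nil, false_imp_iff,
    implies_true, and_true]
  refine ⟨key isSeparating_tableRG1, key isSeparating_tableRG2, key isSeparating_tableRG3,
    key isSeparating_tableRBQ, key isSeparating_tableRC2, key isSeparating_tableRC4,
    fun W hW => ?_, key isSeparating_tableLAQ, key isSeparating_tableLNQ, key isSeparating_tableCQ,
    key isSeparating_tableFQ, key isSeparating_tableMNQ, key isSeparating_tableLC1,
    key isSeparating_chein_dihedralGroup_three, key isSeparating_chein_dihedralGroup_four⟩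
  by_cases h : W = .RG2
  · subst h
    obtain ⟨Q, hQ, h⟩ := key isSeparating_tableLC1 .RG2 (by decide)
    exact ⟨Q, VarietyName.variety_subset_of_mem_upperCovers (V := .LC1) (by decide) hQ, h⟩
  · obtain ⟨Q, hQ, h', -⟩ := isSeparating_tableLC3.exists_mem.{u}
    exact ⟨Q, hQ, h' W fun hW' => (List.mem_cons.1 hW').elim h hW⟩

theorem VarietyName.exists_mem_notMem {V W : VarietyName} (h : W ∉ V.above) :
    ∃ Q ∈ VarietyName.variety.{u} V, Q ∉ W.variety := by
  rcases V.mem_representatives with rfl | hV | hV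
  · exact absurd W.mem_above_GR h
  · exact exists_mem_notMem_of_mem_representatives V hV W h
  · obtain ⟨Q, hQ, hW⟩ := exists_mem_notMem_of_mem_representatives _ hV W.dual
      fun h' => h (mem_above_dual V W h')
    refine ⟨Q.opposite, opposite_mem_variety.2 hQ, fun h' => hW (opposite_mem_variety.1 h')⟩

theorem VarietyName.mem_above_of_subset {V W : VarietyName}
    (h : VarietyName.variety.{u} V ⊆ W.variety) : W ∈ V.above := by
  by_contra hW
  obtain ⟨Q, hQ, hQ'⟩ := exists_mem_notMem.{u} hW
  exact hQ' (h hQ)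

theorem VarietyName.variety_subset_iff {V W : VarietyName} :
    VarietyName.variety.{u} V ⊆ W.variety ↔ V.Below W :=
  ⟨fun h => below_of_mem_above (mem_above_of_subset h), fun h => h.variety_subset⟩

theorem VarietyName.variety_injective : Function.Injective VarietyName.variety.{u} :=
  fun V W h => above_antisymm V W (mem_above_of_subset h.subset) (mem_above_of_subset h.superset)

/-! ### The varieties of Bol-Moufang type -/

theorem setOf_isBolMoufang_models :
    {𝒱 : Set QuasigroupObj.{u} | ∃ I : Identity, I.IsBolMoufang ∧ 𝒱 = I.models} =
      Set.range VarietyName.variety := by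
  ext 𝒱
  constructor
  · rintro ⟨J, hJ, rfl⟩
    obtain ⟨V, I, hI, hJI⟩ := hJ.exists_variety
    exact ⟨V, by rw [hJI.models_eq, VarietyName.models_eq_variety hI]⟩
  · rintro ⟨V, rfl⟩
    obtain ⟨I, hI, hBM⟩ := V.exists_isBolMoufang
    exact ⟨I, hBM, (VarietyName.models_eq_variety hI).symm⟩

theorem Identity.IsBolMoufang.models_eq_variety_iff {V : VarietyName} {J : Identity}
    (hJ : J.IsBolMoufang) :
    J.models = VarietyName.variety.{u} V ↔ ∃ I ∈ V.equivalentIdentities, J.SameUpToRenaming I := by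
  constructor
  · intro h
    obtain ⟨W, I, hI, hJI⟩ := hJ.exists_variety
    rw [hJI.models_eq, VarietyName.models_eq_variety hI] at h
    exact VarietyName.variety_injective h ▸ ⟨I, hI, hJI⟩
  · rintro ⟨I, hI, hJI⟩
    rw [hJI.models_eq, VarietyName.models_eq_variety hI]

/-! ### Sharpness of the claims about neutral elements -/

theorem IsLoop.isRightLoop {Q : QuasigroupObj.{u}} (h : IsLoop Q) : IsRightLoop Q :=
  h.imp fun _ he a => (he a).2

theorem exists_not_isLoop : ∀ V ∈ varietiesOfLeftLoops,
    ∃ Q ∈ VarietyName.variety.{u} V, ¬ IsLoop Q := by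
  have key {α : Type} [Mul α] [Finite α] [Nonempty α] {V : VarietyName} {L : List VarietyName}
      (h : IsSeparating α V L) (h' : ∀ e : α, ∃ a, a * e ≠ a) :
      ∃ Q ∈ VarietyName.variety.{u} V, ¬ IsLoop Q := by
    obtain ⟨Q, hQ, -, -, h⟩ := h.exists_mem
    exact ⟨Q, hQ, fun hl => h h' hl.isRightLoop⟩
  simp only [varietiesOfLeftLoops, List.forall_mem_cons, List.not_mem_nil, false_imp_iff,
    implies_true, and_true]
  exact ⟨key isSeparating_tableRG1 (by decide), key isSeparating_tableRG2 (by decide),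
    key isSeparating_tableRG3 (by decide), key isSeparating_tableRBQ (by decide),
    key isSeparating_tableRC4 (by decide), key isSeparating_tableLC3 (by decide),
    key isSeparating_tableLAQ (by decide), key isSeparating_tableLNQ (by decide)⟩

theorem exists_not_isLeftLoop_and_exists_not_isRightLoop {V : VarietyName}
    (h : V.neutralType = .none) :
    (∃ Q ∈ VarietyName.variety.{u} V, ¬ IsLeftLoop Q) ∧
      ∃ Q ∈ VarietyName.variety.{u} V, ¬ IsRightLoop Q := by
  have key {α : Type} [Mul α] [Finite α] [Nonempty α] {V : VarietyName} {L : List VarietyName}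
      (h : IsSeparating α V L) (h' : (∀ e : α, ∃ a, e * a ≠ a) ∧ ∀ e : α, ∃ a, a * e ≠ a) :
      ∃ Q ∈ VarietyName.variety.{u} V, ¬ IsLeftLoop Q ∧ ¬ IsRightLoop Q := by
    obtain ⟨Q, hQ, -, h₁, h₂⟩ := h.exists_mem
    exact ⟨Q, hQ, h₁ h'.1, h₂ h'.2⟩
  have hRC2 := key isSeparating_tableRC2 (by decide)
  suffices ∃ Q ∈ VarietyName.variety.{u} V, ¬ IsLeftLoop Q ∧ ¬ IsRightLoop Q from
    ⟨this.imp fun _ h => ⟨h.1, h.2.1⟩, this.imp fun _ h => ⟨h.1, h.2.2⟩⟩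
  cases V
  case RC2 => exact hRC2
  case LC2 =>
    obtain ⟨Q, hQ, hl, hr⟩ := hRC2
    exact ⟨Q.opposite, VarietyName.opposite_mem_variety.2 hQ, isLeftLoop_opposite.not.2 hr,
      isRightLoop_opposite.not.2 hl⟩
  case FQ => exact key isSeparating_tableFQ (by decide)
  case CQ => exact key isSeparating_tableCQ (by decide)
  all_goals cases h

theorem VarietyName.mem_varietiesOfLeftLoops : ∀ V : VarietyName,
    V.neutralType = .left → V ∈ varietiesOfLeftLoops := by
  intro V h
  cases V <;> first | decide | cases h

theorem VarietyName.mem_varietiesOfLeftLoops_dual : ∀ V : VarietyName,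
    V.neutralType = .right → V.dual ∈ varietiesOfLeftLoops := by
  intro V h
  cases V <;> first | decide | cases h

theorem VarietyName.isLoop_of_neutralType_eq_two {V : VarietyName} (h : V.neutralType = .two)
    {Q : QuasigroupObj.{u}} (hQ : Q ∈ V.variety) : IsLoop Q := by
  cases V
  case GR =>
    exact isLoop_of_mem (V := .EQ) (by decide) (variety_subset_of_mem_upperCovers (by decide) hQ)
  case RC1 =>
    exact isLoop_opposite.1
      (isLoop_of_mem (V := .LC1) (by decide) (opposite_mem_variety.2 hQ))
  case EQ | MQ | LC1 | MNQ => exact isLoop_of_mem (by decide) hQ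
  all_goals cases h

theorem VarietyName.neutralType_describes (V : VarietyName) :
    V.neutralType.Describes (VarietyName.variety.{u} V) := by
  cases h : V.neutralType
  · exact fun Q hQ => isLoop_of_neutralType_eq_two h hQ
  · have hV := V.mem_varietiesOfLeftLoops h
    exact ⟨fun Q hQ => isLeftLoop_of_mem hV hQ, exists_not_isLoop V hV⟩
  · have hV := V.mem_varietiesOfLeftLoops_dual h
    obtain ⟨Q, hQ, hQ'⟩ := exists_not_isLoop _ hV
    exact ⟨fun Q hQ => isRightLoop_of_mem hV hQ, Q.opposite, opposite_mem_variety.2 hQ,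
      isLoop_opposite.not.2 hQ'⟩
  · exact exists_not_isLeftLoop_and_exists_not_isRightLoop h

end BolMoufang

theorem mainTheorem1 :
    -- there are exactly 26 varieties of quasigroups of Bol-Moufang type
    {𝒱 : Set BolMoufang.QuasigroupObj.{u} |
        ∃ I : BolMoufang.Identity, I.IsBolMoufang ∧ 𝒱 = I.models}.ncard = 26 ∧
    -- they are the listed ones, which are pairwise distinct
    {𝒱 : Set BolMoufang.QuasigroupObj.{u} |
        ∃ I : BolMoufang.Identity, I.IsBolMoufang ∧ 𝒱 = I.models} =
      Set.range BolMoufang.VarietyName.variety.{u} ∧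
    Function.Injective BolMoufang.VarietyName.variety.{u} ∧
    -- the maximal sets of equivalent identities
    (∀ (V : BolMoufang.VarietyName) (J : BolMoufang.Identity), J.IsBolMoufang →
      (J.models = BolMoufang.VarietyName.variety.{u} V ↔
        ∃ I ∈ V.equivalentIdentities, J.SameUpToRenaming I)) ∧
    -- all inclusions and non-inclusions
    (∀ V W : BolMoufang.VarietyName,
      BolMoufang.VarietyName.variety.{u} V ⊆ BolMoufang.VarietyName.variety.{u} W ↔
        V.Below W) ∧
    -- the behaviour with respect to neutral elements
    (∀ V : BolMoufang.VarietyName,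
      V.neutralType.Describes (BolMoufang.VarietyName.variety.{u} V)) := by
  refine ⟨?_, BolMoufang.setOf_isBolMoufang_models, BolMoufang.VarietyName.variety_injective,
    fun V J hJ => hJ.models_eq_variety_iff, fun V W => BolMoufang.VarietyName.variety_subset_iff,
    BolMoufang.VarietyName.neutralType_describes⟩
  rw [BolMoufang.setOf_isBolMoufang_models, ← Set.image_univ,
    Set.ncard_image_of_injective _ BolMoufang.VarietyName.variety_injective, Set.ncard_univ,
    Nat.card_eq_fintype_card]
  rfl
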